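/- **Setting.** Let $Cl(W_B)$ be the complex Clifford algebra generated by the neutral fermions $\phi_n$, $n\in\mathbb Z$, with $\phi_m\phi_n+\phi_n\phi_m=(-1)^m\delta_{m,-n}$. Let $$\mathcal F_B=Cl(W_B)\big/Cl(W_B)\Big(\sum_{n<0}\mathbb C\phi_n\Big),\qquad \mathcal F_B^*=Cl(W_B)\big/\Big(\sum_{n>0}\mathbb C\phi_n\Big)Cl(W_B),$$ with vacua $|0\rangle$, $\langle 0|$ (the classes of $1$), and with the pairing $\langle U|V\rangle$ determined by $(\langle0|a,\,b|0\rangle)\mapsto\langle ab\rangle$. Here $\langle\cdot\rangle$ is the vacuum expectation value: $\langle1\rangle=1$, $\langle\phi_n\rangle=0$, $\langle\phi_m\phi_n\rangle=(-1)^m\delta_{m,-n}$ for $n>0$, $\frac12\delta_{m,0}$ for $n=0$ and $0$ for $n<0$, extended by Wick's theorem. For odd $n$ put $H_n=\frac12\sum_{i\in\mathbb Z}(-1)^{i+1}\phi_i\phi_{-i-n}$, and $$H_+(t)=\sum_{k\ge1\text{ odd}}t_kH_k,\qquad H_-(t)=\sum_{k\ge1\text{ odd}}t_{-k}H_{-k}.$$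 Write $t_\pm=(t_{\pm1},t_{\pm3},\dots)$, $\xi(s,z)=\sum_{k\ge1\text{ odd}}s_kz^k$ and $[z]=(2z,\tfrac{2z^3}{3},\tfrac{2z^5}{5},\dots)$. Let $G$ be an operator in the completion of $Cl(W_B)$, that is, a bilinear form $\langle U|G|V\rangle$ on $\mathcal F_B^*\times\mathcal F_B$ any finitely many values of which are those of some element of $Cl(W_B)$. Assume that $G$ satisfies the basic bilinear condition: for all $U,U'\in\mathcal F_B^*$ and $V,V'\in\mathcal F_B$, $$\sum_{n\in\mathbb Z}(-1)^n\langle U|G\phi_n|V\rangle\langle U'|G\phi_{-n}|V'\rangle=\sum_{n\in\mathbb Z}(-1)^n\langle U|\phi_nG|V\rangle\langle U'|\phi_{-n}G|V'\rangle .$$ **Proposition (negative BKP hierarchy).** Define the formal power series $\tau(t_+,t_-)=\langle0|e^{H_+(t)}Ge^{H_-(t)}|0\rangle$. Then $\tau(t_+,t_-)=2\langle0|\phi_0e^{H_+(t)}Ge^{H_-(t)}\phi_0|0\rangle$, and, as formal power series in $t_\pm,t'_\pm$, $$\oint_{C_\infty}e^{\xi(t_+-t'_+,z)}\tau(t_+-[z^{-1}],t_-)\,\tau(t'_++[z^{-1}],t'_-)\frac{dz}{2\pi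 iz} =\oint_{C_0}e^{\xi(t'_--t_-,z^{-1})}\tau(t_+,t_-+[z])\,\tau(t'_+,t'_--[z])\frac{dz}{2\pi iz}.$$ Here the integral over $C_\infty$ (respectively $C_0$) means the coefficient of $z^0$ of the integrand, each coefficient of which with respect to the times is expanded as a Laurent series in $z^{-1}$ (respectively in $z$). The first member of the hierarchy is $$D_{-1}(D_3-D_1^3)\,\tau\cdot\tau=0,$$ where the Hirota derivatives are defined by $D_{s_1}\cdots D_{s_r}f\cdot g=\prod_j(\partial_{t_{s_j}}-\partial_{t'_{s_j}})f(t)g(t')\big|_{t'=t}$. It holds for the above $\tau$, and more generally for every formal power series $\tau\in\mathbb C[[t_+,t_-]]$ that satisfies the displayed bilinear identity. -/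

import Mathlib

open scoped Nat

noncomputable section

namespace NegBKP

/-! ### Neutral fermions -/

/-- The space `W_B` with basis `φ_n`, `n ∈ ℤ`. -/
abbrev W : Type := ℤ →₀ ℂ

/-- The bilinear form on `W_B` with values `c m n` on the basis. -/
def bil (c : ℤ → ℤ → ℂ) : LinearMap.BilinForm ℂ W :=
  Finsupp.linearCombination ℂ (fun m => Finsupp.linearCombination ℂ (c m))

theorem bil_single (c : ℤ → ℤ → ℂ) (m n : ℤ) :
    bil c (Finsupp.single m 1) (Finsupp.single n 1) = c m n := by
  simp [bil]

/-- The anticommutator `[φ_m, φ_n]_+ = (-1)^m δ_{m,-n}`. -/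
def anti (m n : ℤ) : ℂ := if m = -n then (-1) ^ m else 0

/-- The quadratic form `Q` with `φ(v)^2 = Q(v)`. -/
def Q : QuadraticForm ℂ W := (1 / 2 : ℂ) • (bil anti).toQuadraticMap

/-- The Clifford algebra `Cl(W_B)`. -/
abbrev Cl : Type := CliffordAlgebra Q

/-- The neutral fermion `φ_n`. -/
def phi (n : ℤ) : Cl := CliffordAlgebra.ι Q (Finsupp.single n 1)

theorem negOne_zpow_neg (n : ℤ) : ((-1 : ℂ)) ^ (-n) = (-1) ^ n := by
  rw [zpow_neg, ← inv_zpow, inv_neg_one]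

theorem anti_comm (m n : ℤ) : anti m n = anti n m := by
  unfold anti
  by_cases h : m = -n
  · subst h
    rw [if_pos rfl, if_pos (neg_neg n).symm, negOne_zpow_neg]
  · rw [if_neg h, if_neg (by omega)]

theorem bil_flip (c : ℤ → ℤ → ℂ) : (bil c).flip = bil (fun m n => c n m) := by
  ext m n
  simp [bil]

theorem polar_Q (v w : W) : QuadraticMap.polar Q v w = bil anti v w := by
  have h : bil anti w v = bil anti v w := by
    have h1 : (bil anti).flip = bil anti := by
      rw [bil_flip]; congr 1; funext m n; exact anti_comm n m
    calc bil anti w v = (bil anti).flip v w := rfl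
      _ = _ := by rw [h1]
  simp only [QuadraticMap.polar, Q, smul_apply,
    LinearMap.BilinMap.toQuadraticMap_apply, map_add, LinearMap.add_apply, h, smul_eq_mul]
  ring

/-- The defining relation `[φ_m, φ_n]_+ = (-1)^m δ_{m,-n}`. -/
theorem phi_anticomm (m n : ℤ) :
    phi m * phi n + phi n * phi m = algebraMap ℂ Cl (anti m n) := by
  rw [phi, phi, CliffordAlgebra.ι_mul_ι_add_swap, polar_Q, bil_single]

/-! ### Vacuum expectation values -/

/-- The contractions `⟨φ_m φ_n⟩`. -/
def contr (m n : ℤ) : ℂ :=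
  if 0 < n then (if m = -n then (-1) ^ m else 0)
  else if n = 0 then (if m = 0 then 1 / 2 else 0) else 0

theorem contr_add (m n : ℤ) : contr m n + contr n m = anti m n := by
  unfold contr anti
  by_cases h : m = -n
  · subst h
    rcases lt_trichotomy n 0 with h | h | h
    · have h1 : ¬ (0 < n) := by omega
      have h2 : n ≠ 0 := by omega
      simp [h1, h2, h, ← inv_zpow]
    · subst h; norm_num
    · have h2 : n ≠ 0 := by omega
      have h3 : ¬ (n < 0) := by omega
      simp [h, h2, h3]
  · have h2 : ¬ (n = -m) := by omega
    by_cases hn : n = 0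
    · subst hn
      have : m ≠ 0 := by simpa using h
      simp [this]
    · by_cases hm : m = 0
      · subst hm
        simp [hn]
      · simp [h, h2, hn, hm]

theorem contr_form : (-bil contr).toQuadraticMap = (0 : QuadraticForm ℂ W) - Q := by
  ext v
  have h : bil contr v v + bil contr v v = bil anti v v := by
    have h1 : bil contr + (bil contr).flip = bil anti := by
      rw [bil_flip]
      ext m n
      simp [bil, contr_add]
    calc bil contr v v + bil contr v v = (bil contr + (bil contr).flip) v v := rfl
      _ = _ := by rw [h1]
  simp only [Q, LinearMap.BilinMap.toQuadraticMap_apply, LinearMap.neg_apply,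
    sub_apply, zero_apply, smul_apply, smul_eq_mul, ← h]
  ring

/-- Wick's theorem as a linear map: normal ordering relative to the contractions
`⟨φ_m φ_n⟩`, with values in the exterior algebra. -/
def normalOrder : Cl →ₗ[ℂ] ExteriorAlgebra ℂ W :=
  CliffordAlgebra.changeForm contr_form

/-- The vacuum expectation value `⟨a⟩ = ⟨0|a|0⟩` on `Cl(W_B)`: the scalar part of the normally
ordered form of `a`. -/
def vev : Cl →ₗ[ℂ] ℂ :=
  (ExteriorAlgebra.algebraMapInv (R := ℂ) (M := W)).toLinearMap ∘ₗ normalOrder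

theorem normalOrder_phi_mul (m : ℤ) (x : Cl) :
    normalOrder (phi m * x) = ExteriorAlgebra.ι ℂ (Finsupp.single m 1) * normalOrder x
      + CliffordAlgebra.contractLeft (bil contr (Finsupp.single m 1)) (normalOrder x) := by
  rw [phi, normalOrder, CliffordAlgebra.changeForm_ι_mul]
  simp [ExteriorAlgebra.ι]

theorem vev_one : vev 1 = 1 := by
  simp [vev, normalOrder]

theorem vev_phi (n : ℤ) : vev (phi n) = 0 := by
  have : normalOrder (phi n) = ExteriorAlgebra.ι ℂ (Finsupp.single n 1) := by
    rw [phi, normalOrder, CliffordAlgebra.changeForm_ι]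
  simp [vev, this, ExteriorAlgebra.algebraMapInv]

theorem vev_phi_mul_phi (m n : ℤ) : vev (phi m * phi n) = contr m n := by
  have h : normalOrder (phi n) = ExteriorAlgebra.ι ℂ (Finsupp.single n 1) := by
    rw [phi, normalOrder, CliffordAlgebra.changeForm_ι]
  have h2 : CliffordAlgebra.contractLeft (bil contr (Finsupp.single m 1))
      (ExteriorAlgebra.ι ℂ (Finsupp.single n 1 : W)) = algebraMap ℂ _ (contr m n) := by
    rw [← bil_single contr m n]
    exact CliffordAlgebra.contractLeft_ι _ _ _
  rw [vev, LinearMap.comp_apply, normalOrder_phi_mul, h, h2]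
  simp [ExteriorAlgebra.algebraMapInv]

theorem vev_phi_mul (m : ℤ) (hm : 0 < m) (x : Cl) : vev (phi m * x) = 0 := by
  have h0 : bil contr (Finsupp.single m 1) = 0 := by
    ext n
    simp only [LinearMap.comp_apply, Finsupp.lsingle_apply, LinearMap.zero_apply, bil_single, contr]
    split_ifs <;> first | rfl | omega
  rw [vev, LinearMap.comp_apply, normalOrder_phi_mul, h0]
  simp [ExteriorAlgebra.algebraMapInv]

theorem contractLeft_mul_iota (d : Module.Dual ℂ W) (v : W) (hd : d v = 0)
    (y : ExteriorAlgebra ℂ W) :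
    CliffordAlgebra.contractLeft d (y * ExteriorAlgebra.ι ℂ v) =
      CliffordAlgebra.contractLeft d y * ExteriorAlgebra.ι ℂ v := by
  induction y using CliffordAlgebra.left_induction with
  | algebraMap r =>
    rw [CliffordAlgebra.contractLeft_algebraMap_mul, CliffordAlgebra.contractLeft_algebraMap]
    have : CliffordAlgebra.contractLeft d (ExteriorAlgebra.ι ℂ v) = 0 := by
      rw [ExteriorAlgebra.ι, CliffordAlgebra.contractLeft_ι, hd, map_zero]
    simp [this]
  | add x y hx hy => rw [add_mul, map_add, hx, hy, map_add, add_mul]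
  | ι_mul x m hx =>
    rw [mul_assoc, CliffordAlgebra.contractLeft_ι_mul, hx, CliffordAlgebra.contractLeft_ι_mul,
      sub_mul, smul_mul_assoc, mul_assoc]

theorem normalOrder_mul_phi (n : ℤ) (hn : n < 0) (x : Cl) :
    normalOrder (x * phi n) = normalOrder x * ExteriorAlgebra.ι ℂ (Finsupp.single n 1) := by
  have h0 (v : W) : bil contr v (Finsupp.single n 1) = 0 := by
    have : (bil contr).flip (Finsupp.single n 1) = 0 := by
      rw [bil_flip]
      ext m
      simp only [LinearMap.comp_apply, Finsupp.lsingle_apply, LinearMap.zero_apply, bil_single,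
        contr]
      split_ifs <;> first | rfl | omega
    calc bil contr v (Finsupp.single n 1) = (bil contr).flip (Finsupp.single n 1) v := rfl
      _ = 0 := by rw [this]; rfl
  induction x using CliffordAlgebra.left_induction with
  | algebraMap r =>
    rw [← Algebra.smul_def, map_smul, normalOrder, CliffordAlgebra.changeForm_algebraMap, phi,
      CliffordAlgebra.changeForm_ι, Algebra.smul_def]
  | add x y hx hy => rw [add_mul, map_add, hx, hy, map_add, add_mul]
  | ι_mul x m hx =>
    have key (y : Cl) : normalOrder (CliffordAlgebra.ι Q m * y) =
        ExteriorAlgebra.ι ℂ m * normalOrder y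
          + CliffordAlgebra.contractLeft (bil contr m) (normalOrder y) := by
      rw [normalOrder, CliffordAlgebra.changeForm_ι_mul]
      simp [ExteriorAlgebra.ι]
    rw [mul_assoc, key, key, hx, contractLeft_mul_iota _ _ (h0 m), add_mul, mul_assoc]

theorem vev_mul_phi (n : ℤ) (hn : n < 0) (x : Cl) : vev (x * phi n) = 0 := by
  rw [vev, LinearMap.comp_apply, normalOrder_mul_phi n hn]
  simp [ExteriorAlgebra.algebraMapInv]

/-! ### Fock spaces -/

/-- The left ideal `Cl(W_B) (∑_{n<0} ℂ φ_n)`. -/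
def ann : Submodule ℂ Cl := Submodule.span ℂ {y | ∃ (x : Cl) (n : ℤ), n < 0 ∧ y = x * phi n}

/-- The right ideal `(∑_{n>0} ℂ φ_n) Cl(W_B)`. -/
def cre : Submodule ℂ Cl := Submodule.span ℂ {y | ∃ (x : Cl) (n : ℤ), 0 < n ∧ y = phi n * x}

/-- The right Fock space `F_B`. -/
abbrev FockR : Type := Cl ⧸ ann

/-- The left Fock space `F_B^*`. -/
abbrev FockL : Type := Cl ⧸ cre

/-- The vector `a|0⟩`. -/
def ketOf : Cl →ₗ[ℂ] FockR := ann.mkQ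

/-- The vector `⟨0|a`. -/
def braOf : Cl →ₗ[ℂ] FockL := cre.mkQ

theorem ann_le (a : Cl) : ann ≤ ann.comap (LinearMap.mulLeft ℂ a) := by
  refine Submodule.span_le.2 ?_
  rintro _ ⟨x, n, hn, rfl⟩
  exact Submodule.subset_span ⟨a * x, n, hn, (mul_assoc _ _ _).symm⟩

theorem cre_le (a : Cl) : cre ≤ cre.comap (LinearMap.mulRight ℂ a) := by
  refine Submodule.span_le.2 ?_
  rintro _ ⟨x, n, hn, rfl⟩
  exact Submodule.subset_span ⟨x * a, n, hn, mul_assoc _ _ _⟩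

/-- The left action `|V⟩ ↦ a|V⟩` of `Cl(W_B)` on `F_B`. -/
def actR (a : Cl) : FockR →ₗ[ℂ] FockR := ann.mapQ ann (LinearMap.mulLeft ℂ a) (ann_le a)

/-- The right action `⟨U| ↦ ⟨U|a` of `Cl(W_B)` on `F_B^*`. -/
def actL (a : Cl) : FockL →ₗ[ℂ] FockL := cre.mapQ cre (LinearMap.mulRight ℂ a) (cre_le a)

theorem actR_ketOf (a b : Cl) : actR a (ketOf b) = ketOf (a * b) := rfl

theorem actL_braOf (a b : Cl) : actL a (braOf b) = braOf (b * a) := rfl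

/-- The pairing `⟨U|V⟩` of `F_B^*` and `F_B`, determined by `(⟨0|a, b|0⟩) ↦ ⟨ab⟩`. -/
def pairing : FockL →ₗ[ℂ] FockR →ₗ[ℂ] ℂ :=
  cre.liftQ
    { toFun := fun a => ann.liftQ (vev ∘ₗ LinearMap.mulLeft ℂ a) (by
        refine Submodule.span_le.2 ?_
        rintro _ ⟨x, n, hn, rfl⟩
        change vev (a * (x * phi n)) = 0
        rw [← mul_assoc, vev_mul_phi n hn])
      map_add' := fun a b => by
        apply Submodule.linearMap_qext
        ext x
        change vev ((a + b) * x) = vev (a * x) + vev (b * x)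
        rw [add_mul, map_add]
      map_smul' := fun c a => by
        apply Submodule.linearMap_qext
        ext x
        change vev ((c • a) * x) = c • vev (a * x)
        rw [smul_mul_assoc, map_smul] }
    (by
      refine Submodule.span_le.2 ?_
      rintro _ ⟨x, n, hn, rfl⟩
      apply Submodule.linearMap_qext
      ext y
      change vev (phi n * x * y) = 0
      rw [mul_assoc, vev_phi_mul n hn])

theorem pairing_apply (a b : Cl) : pairing (braOf a) (ketOf b) = vev (a * b) := rfl

theorem actR_mul (a b : Cl) (v : FockR) : actR (a * b) v = actR a (actR b v) := by
  obtain ⟨x, rfl⟩ := Submodule.Quotient.mk_surjective _ v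
  exact congrArg ketOf (mul_assoc a b x)

theorem actL_mul (a b : Cl) (v : FockL) : actL (a * b) v = actL b (actL a v) := by
  obtain ⟨x, rfl⟩ := Submodule.Quotient.mk_surjective _ v
  exact congrArg braOf (mul_assoc x a b).symm

theorem actR_anticomm (m n : ℤ) (v : FockR) :
    actR (phi m) (actR (phi n) v) = anti m n • v - actR (phi n) (actR (phi m) v) := by
  obtain ⟨x, rfl⟩ := Submodule.Quotient.mk_surjective _ v
  change ketOf (phi m * (phi n * x)) = anti m n • ketOf x - ketOf (phi n * (phi m * x))
  rw [← map_smul, ← map_sub, Algebra.smul_def, ← phi_anticomm]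
  congr 1
  noncomm_ring

theorem actL_anticomm (m n : ℤ) (v : FockL) :
    actL (phi n) (actL (phi m) v) = anti m n • v - actL (phi m) (actL (phi n) v) := by
  obtain ⟨x, rfl⟩ := Submodule.Quotient.mk_surjective _ v
  change braOf (x * phi m * phi n) = anti m n • braOf x - braOf (x * phi n * phi m)
  rw [← map_smul, ← map_sub, Algebra.smul_def, Algebra.commutes, ← phi_anticomm]
  congr 1
  noncomm_ring

theorem anti_of_ne (m n : ℤ) (h : m ≠ -n) : anti m n = 0 := if_neg h

/-- `φ_n|V⟩ = 0` for all sufficiently negative `n`. -/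
theorem actR_bdd (v : FockR) : ∃ N : ℤ, 0 ≤ N ∧ ∀ n < -N, actR (phi n) v = 0 := by
  obtain ⟨x, rfl⟩ := Submodule.Quotient.mk_surjective _ v
  change ∃ N : ℤ, 0 ≤ N ∧ ∀ n < -N, ketOf (phi n * x) = 0
  induction x using CliffordAlgebra.left_induction with
  | algebraMap r =>
    refine ⟨0, le_rfl, fun n hn => (Submodule.Quotient.mk_eq_zero _).2 ?_⟩
    exact Submodule.subset_span ⟨algebraMap ℂ Cl r, n, by omega, (Algebra.commutes _ _).symm⟩
  | add x y hx hy =>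
    obtain ⟨N, hN, h⟩ := hx
    obtain ⟨M, hM, h'⟩ := hy
    refine ⟨max N M, by omega, fun n hn => ?_⟩
    rw [mul_add, map_add, h n (by omega), h' n (by omega), add_zero]
  | ι_mul x m hx =>
    obtain ⟨N, hN, h⟩ := hx
    induction m using Finsupp.induction_linear with
    | zero => exact ⟨0, le_rfl, fun n _ => by simp⟩
    | add p q hp hq =>
      obtain ⟨K, hK, h1⟩ := hp
      obtain ⟨M, hM, h2⟩ := hq
      refine ⟨max K M, by omega, fun n hn => ?_⟩
      rw [map_add, add_mul, mul_add, map_add, h1 n (by omega), h2 n (by omega), add_zero]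
    | single k c =>
      refine ⟨max N |k|, by omega, fun n hn => ?_⟩
      have e : (Finsupp.single k c : W) = c • Finsupp.single k 1 := by simp
      have hk := le_abs_self k
      have key : ketOf (phi n * (phi k * x)) = 0 := by
        have h1 := actR_anticomm n k (ketOf x)
        simp only [actR_ketOf] at h1
        have h2 : ketOf (phi k * (phi n * x)) = 0 := by
          rw [← actR_ketOf, h n (by omega), map_zero]
        rw [h1, h2, anti_of_ne n k (by omega), zero_smul, sub_zero]
      rw [e, map_smul, smul_mul_assoc, mul_smul_comm, map_smul]
      exact (congrArg (c • ·) key).trans (smul_zero c)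

/-- `⟨U|φ_n = 0` for all sufficiently large `n`. -/
theorem actL_bdd (v : FockL) : ∃ N : ℤ, 0 ≤ N ∧ ∀ n > N, actL (phi n) v = 0 := by
  obtain ⟨x, rfl⟩ := Submodule.Quotient.mk_surjective _ v
  change ∃ N : ℤ, 0 ≤ N ∧ ∀ n > N, braOf (x * phi n) = 0
  induction x using CliffordAlgebra.right_induction with
  | algebraMap r =>
    refine ⟨0, le_rfl, fun n hn => (Submodule.Quotient.mk_eq_zero _).2 ?_⟩
    exact Submodule.subset_span ⟨algebraMap ℂ Cl r, n, by omega, Algebra.commutes _ _⟩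
  | add x y hx hy =>
    obtain ⟨N, hN, h⟩ := hx
    obtain ⟨M, hM, h'⟩ := hy
    refine ⟨max N M, by omega, fun n hn => ?_⟩
    rw [add_mul, map_add, h n (by omega), h' n (by omega), add_zero]
  | mul_ι m x hx =>
    obtain ⟨N, hN, h⟩ := hx
    induction m using Finsupp.induction_linear with
    | zero => exact ⟨0, le_rfl, fun n _ => by simp⟩
    | add p q hp hq =>
      obtain ⟨K, hK, h1⟩ := hp
      obtain ⟨M, hM, h2⟩ := hq
      refine ⟨max K M, by omega, fun n hn => ?_⟩
      rw [map_add, mul_add, add_mul, map_add, h1 n (by omega), h2 n (by omega), add_zero]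
    | single k c =>
      refine ⟨max N |k|, by omega, fun n hn => ?_⟩
      have e : (Finsupp.single k c : W) = c • Finsupp.single k 1 := by simp
      have hk := neg_le_abs k
      have key : braOf (x * phi k * phi n) = 0 := by
        have h1 := actL_anticomm k n (braOf x)
        simp only [actL_braOf] at h1
        have h2 : braOf (x * phi n * phi k) = 0 := by
          rw [← actL_braOf, h n (by omega), map_zero]
        rw [h1, h2, anti_of_ne k n (by omega), zero_smul, sub_zero]
      rw [e, map_smul, mul_smul_comm, smul_mul_assoc, map_smul]
      exact (congrArg (c • ·) key).trans (smul_zero c)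

/-! ### The Hamiltonians

`H_n = (1/2) ∑_{i ∈ ℤ} (-1)^{i+1} φ_i φ_{-i-n}` for `n ≠ 0`: applied to a vector, all but finitely
many terms of the sum vanish. -/

theorem hamR_finite (n : ℤ) (hn : n ≠ 0) (v : FockR) :
    (Function.support fun i : ℤ =>
      ((-1 : ℂ) ^ (i + 1)) • actR (phi i * phi (-i - n)) v).Finite := by
  obtain ⟨N, hN, h⟩ := actR_bdd v
  refine (Set.finite_Icc (-N) (N + |n|)).subset fun i hi => ?_
  have a1 := le_abs_self n
  have a2 := neg_le_abs n
  by_contra hc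
  refine hi ?_
  simp only [actR_mul]
  rw [Set.mem_Icc, not_and_or, not_le, not_le] at hc
  rcases hc with hc | hc
  · rw [actR_anticomm, anti_of_ne _ _ (by omega), h i (by omega)]
    simp
  · rw [h (-i - n) (by omega)]
    simp

theorem hamL_finite (n : ℤ) (hn : n ≠ 0) (v : FockL) :
    (Function.support fun i : ℤ =>
      ((-1 : ℂ) ^ (i + 1)) • actL (phi i * phi (-i - n)) v).Finite := by
  obtain ⟨N, hN, h⟩ := actL_bdd v
  refine (Set.finite_Icc (-N - |n|) N).subset fun i hi => ?_
  have a1 := le_abs_self n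
  have a2 := neg_le_abs n
  by_contra hc
  refine hi ?_
  simp only [actL_mul]
  rw [Set.mem_Icc, not_and_or, not_le, not_le] at hc
  rcases hc with hc | hc
  · rw [actL_anticomm, anti_of_ne _ _ (by omega), h (-i - n) (by omega)]
    simp
  · rw [h i (by omega)]
    simp

/-- The operator `H_n`, `n ≠ 0`, on `F_B`. -/
def hamR (n : ℤ) (hn : n ≠ 0) : FockR →ₗ[ℂ] FockR where
  toFun v := (1 / 2 : ℂ) • ∑ᶠ i : ℤ, ((-1 : ℂ) ^ (i + 1)) • actR (phi i * phi (-i - n)) v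
  map_add' v w := by
    rw [← smul_add, ← finsum_add_distrib (hamR_finite n hn v) (hamR_finite n hn w)]
    simp only [map_add, smul_add]
  map_smul' c v := by
    simp only [map_smul, RingHom.id_apply]
    rw [smul_comm c, smul_finsum' c (hamR_finite n hn v)]
    simp only [smul_comm c]

/-- The (right) operator `H_n`, `n ≠ 0`, on `F_B^*`. -/
def hamL (n : ℤ) (hn : n ≠ 0) : FockL →ₗ[ℂ] FockL where
  toFun v := (1 / 2 : ℂ) • ∑ᶠ i : ℤ, ((-1 : ℂ) ^ (i + 1)) • actL (phi i * phi (-i - n)) v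
  map_add' v w := by
    rw [← smul_add, ← finsum_add_distrib (hamL_finite n hn v) (hamL_finite n hn w)]
    simp only [map_add, smul_add]
  map_smul' c v := by
    simp only [map_smul, RingHom.id_apply]
    rw [smul_comm c, smul_finsum' c (hamL_finite n hn v)]
    simp only [smul_comm c]

/-! ### Time variables and exponentials -/

/-- The positive odd integers. -/
abbrev Odds : Type := {k : ℕ // Odd k}

theorem Odds.ne_zero (k : Odds) : ((k : ℕ) : ℤ) ≠ 0 := by
  have := k.2.pos
  omega

/-- `H_k` acting from the right on `F_B^*`. -/
def hPlus (k : Odds) : FockL →ₗ[ℂ] FockL := hamL k k.ne_zero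

/-- `H_{-k}` acting on `F_B`. -/
def hMinus (k : Odds) : FockR →ₗ[ℂ] FockR := hamR (-k) (neg_ne_zero.2 k.ne_zero)

/-- Formal power series in `t_1, t_3, …` with coefficients in `E`. -/
abbrev Series (E : Type) : Type := (Odds →₀ ℕ) → E

/-- The constant series. -/
def Series.const {E : Type} [AddCommGroup E] (v : E) : Series E := fun m => if m = 0 then v else 0

/-- The operator `∑_k t_k H_k` on formal power series. -/
def current {E : Type} [AddCommGroup E] [Module ℂ E] (H : Odds → E →ₗ[ℂ] E)
    (f : Series E) : Series E :=
  fun m => ∑ k ∈ m.support, H k (f (m - Finsupp.single k 1))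

theorem current_iterate_eq_zero {E : Type} [AddCommGroup E] [Module ℂ E]
    (H : Odds → E →ₗ[ℂ] E) (f : Series E) (N : ℕ) :
    ∀ m : Odds →₀ ℕ, m.degree < N → (current H)^[N] f m = 0 := by
  induction N with
  | zero => intro m hm; omega
  | succ N ih =>
    intro m hm
    rw [Function.iterate_succ_apply', current]
    refine Finset.sum_eq_zero fun k hk => ?_
    have h1 : Finsupp.single k 1 ≤ m := by
      rw [Finsupp.single_le_iff]
      exact Nat.one_le_iff_ne_zero.2 (Finsupp.mem_support_iff.1 hk)
    have h2 : (m - Finsupp.single k 1).degree + 1 = m.degree := by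
      have := congrArg Finsupp.degree (tsub_add_cancel_of_le h1)
      simpa using this
    rw [ih _ (by omega), map_zero]

/-- The series `exp(∑_k t_k H_k) f`. The terms of the exponential series of index `N` greater
than `|m|` do not contribute to the coefficient of the monomial `t^m`. -/
def expCurrent {E : Type} [AddCommGroup E] [Module ℂ E] (H : Odds → E →ₗ[ℂ] E)
    (f : Series E) : Series E :=
  fun m => ∑ N ∈ Finset.range (m.degree + 1), ((N ! : ℂ)⁻¹) • (current H)^[N] f m

/-- `⟨U|e^{H_+(t)}`. -/
def braExp (U : FockL) : Series FockL := expCurrent hPlus (Series.const U)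

/-- `e^{H_-(t)}|V⟩`. -/
def ketExp (V : FockR) : Series FockR := expCurrent hMinus (Series.const V)

/-! ### Operators and tau functions -/

/-- An operator given by its matrix elements `⟨U|G|V⟩`. -/
abbrev Op : Type := FockL →ₗ[ℂ] FockR →ₗ[ℂ] ℂ

/-- `G` belongs to the completion of `Cl(W_B)`, i.e. it is a possibly infinite expression in
neutral fermions: any finitely many matrix elements of `G` are those of an element of
`Cl(W_B)`. -/
def IsFermionic (G : Op) : Prop :=
  ∀ s : Finset (FockL × FockR), ∃ a : Cl, ∀ p ∈ s, G p.1 p.2 = pairing p.1 (actR a p.2)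

/-- The basic bilinear condition
`∑_n (-1)^n φ_n G ⊗ φ_{-n} G = ∑_n (-1)^n G φ_n ⊗ G φ_{-n}`, in matrix elements. -/
def BasicBilinear (G : Op) : Prop :=
  ∀ (U U' : FockL) (V V' : FockR),
    ∑ᶠ n : ℤ, (-1 : ℂ) ^ n * (G U (actR (phi n) V) * G U' (actR (phi (-n)) V')) =
      ∑ᶠ n : ℤ, (-1 : ℂ) ^ n * (G (actL (phi n) U) V * G (actL (phi (-n)) U') V')

/-- Both sums in `BasicBilinear` have finitely many nonzero terms. -/
theorem basicBilinear_finite (G : Op) (U U' : FockL) (V V' : FockR) :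
    (Function.support fun n : ℤ =>
      (-1 : ℂ) ^ n * (G U (actR (phi n) V) * G U' (actR (phi (-n)) V'))).Finite ∧
    (Function.support fun n : ℤ =>
      (-1 : ℂ) ^ n * (G (actL (phi n) U) V * G (actL (phi (-n)) U') V')).Finite := by
  constructor
  · obtain ⟨N, hN, h⟩ := actR_bdd V
    obtain ⟨M, hM, h'⟩ := actR_bdd V'
    refine (Set.finite_Icc (-N) M).subset fun n hn => ?_
    by_contra hc
    refine hn ?_
    rw [Set.mem_Icc, not_and_or, not_le, not_le] at hc
    rcases hc with hc | hc
    · simp [h n hc]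
    · simp [h' (-n) (by omega)]
  · obtain ⟨N, hN, h⟩ := actL_bdd U
    obtain ⟨M, hM, h'⟩ := actL_bdd U'
    refine (Set.finite_Icc (-M) N).subset fun n hn => ?_
    by_contra hc
    refine hn ?_
    rw [Set.mem_Icc, not_and_or, not_le, not_le] at hc
    rcases hc with hc | hc
    · simp [h' (-n) (by omega)]
    · simp [h n hc]

/-- The times: `Sum.inl k` is `t_k` and `Sum.inr k` is `t_{-k}`. -/
abbrev Times : Type := Odds ⊕ Odds

/-- `⟨U|e^{H_+(t)} G e^{H_-(t)}|V⟩` as a formal power series in the times. -/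
def matrixElement (G : Op) (U : FockL) (V : FockR) : MvPowerSeries Times ℂ := fun m =>
  G (braExp U (Finsupp.sumFinsuppEquivProdFinsupp m).1)
    (ketExp V (Finsupp.sumFinsuppEquivProdFinsupp m).2)

/-- The tau function `τ(t_+, t_-) = ⟨0|e^{H_+(t)} G e^{H_-(t)}|0⟩`. -/
def tau (G : Op) : MvPowerSeries Times ℂ := matrixElement G (braOf 1) (ketOf 1)

/-! ### Formal contour integrals -/

/-- Two copies of the times: `Sum.inl s` is the time `s` and `Sum.inr s` the primed time `s`. -/
abbrev Times2 : Type := Times ⊕ Times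

/-- The power `w^n` of the variable of `LaurentSeries ℂ = ℂ((w))`. -/
def wPow (n : ℤ) : LaurentSeries ℂ := HahnSeries.single n 1

/-- A formal power series in the variables `σ` and one more variable `w` (written `none`), read as
a power series in the variables `σ` with coefficients in `ℂ((w))`. -/
def toLaurent {σ : Type} (f : MvPowerSeries (Option σ) ℂ) : MvPowerSeries σ (LaurentSeries ℂ) :=
  fun m => HahnSeries.ofPowerSeries ℤ ℂ
    (PowerSeries.mk fun n => MvPowerSeries.coeff (m.optionElim n) f)

open Classical in
/-- The linear series `∑_s c_s t_s`. -/
def linSeries {σ R : Type} [CommRing R] (c : σ → R) : MvPowerSeries σ R :=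
  fun m => ∑ s ∈ m.support, if m = Finsupp.single s 1 then c s else 0

/-- The exponential `e^f` of a power series `f` without constant term. -/
def expSeries {σ : Type} (f : MvPowerSeries σ (LaurentSeries ℂ)) :
    MvPowerSeries σ (LaurentSeries ℂ) := (PowerSeries.exp ℂ).subst f

theorem linSeries_hasSubst {σ : Type} (c : σ → LaurentSeries ℂ) :
    PowerSeries.HasSubst (linSeries c) := by
  refine PowerSeries.HasSubst.of_constantCoeff_zero ?_
  rw [← MvPowerSeries.coeff_zero_eq_constantCoeff_apply]
  change linSeries c 0 = 0
  simp [linSeries]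

/-- The time `s`, placed among the variables by `e` and shifted by `c · 2 w^k / k`
for `s = t_{±k}`. -/
def shiftVar (e : Times → Times2) (cp cm : ℂ) : Times → MvPowerSeries (Option Times2) ℂ
  | Sum.inl k => MvPowerSeries.X (some (e (Sum.inl k))) +
      (cp * (2 / ((k : ℕ) : ℂ))) • MvPowerSeries.X none ^ (k : ℕ)
  | Sum.inr k => MvPowerSeries.X (some (e (Sum.inr k))) +
      (cm * (2 / ((k : ℕ) : ℂ))) • MvPowerSeries.X none ^ (k : ℕ)

theorem shiftVar_hasSubst (e : Times → Times2) (he : Function.Injective e) (cp cm : ℂ) :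
    MvPowerSeries.HasSubst (shiftVar e cp cm) where
  const_coeff s := by
    rcases s with k | k <;> simp [shiftVar, k.2.pos.ne']
  coeff_zero d := by
    classical
    have h1 : {s : Times | d = Finsupp.single (some (e s)) 1}.Finite := by
      refine Set.Subsingleton.finite fun s hs s' hs' => he ?_
      have h := (hs.symm.trans hs' : Finsupp.single _ 1 = Finsupp.single _ 1)
      exact Option.some_injective _ (Finsupp.single_left_injective one_ne_zero h)
    have h2 : {s : Times | d = Finsupp.single none (Sum.elim Subtype.val Subtype.val s)}.Finite := by
      have h3 : {k : Odds | (k : ℕ) = d none}.Finite :=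
        Set.Subsingleton.finite fun k hk k' hk' => Subtype.ext (hk.trans hk'.symm)
      refine ((h3.image Sum.inl).union (h3.image Sum.inr)).subset ?_
      rintro (k | k) hs
      · refine Or.inl ⟨k, ?_, rfl⟩
        rw [Set.mem_ofPred_eq] at hs ⊢
        simp [hs]
      · refine Or.inr ⟨k, ?_, rfl⟩
        rw [Set.mem_ofPred_eq] at hs ⊢
        simp [hs]
    refine (h1.union h2).subset fun s hs => ?_
    by_contra hc
    rw [Set.mem_union, not_or] at hc
    refine hs ?_
    rcases s with k | k
    · have c1 : ¬ d = Finsupp.single (some (e (Sum.inl k))) 1 := hc.1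
      have c2 : ¬ d = Finsupp.single none (k : ℕ) := hc.2
      simp [shiftVar, MvPowerSeries.coeff_X, MvPowerSeries.coeff_X_pow, c1, c2]
    · have c1 : ¬ d = Finsupp.single (some (e (Sum.inr k))) 1 := hc.1
      have c2 : ¬ d = Finsupp.single none (k : ℕ) := hc.2
      simp [shiftVar, MvPowerSeries.coeff_X, MvPowerSeries.coeff_X_pow, c1, c2]

/-- `f(t_+ + cp [w], t_- + cm [w])` with `[w] = (2w, 2w^3/3, 2w^5/5, …)`, the times being renamed
by `e`. -/
def shift (e : Times → Times2) (cp cm : ℂ) (f : MvPowerSeries Times ℂ) :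
    MvPowerSeries Times2 (LaurentSeries ℂ) :=
  toLaurent (MvPowerSeries.subst (shiftVar e cp cm) f)

/-- The contour integral `∮ F dz / (2πi z)` about `w = 0`, where `w` is `z` or `z^{-1}`: the
coefficient of `w^0 = z^0`. -/
def contourIntegral (F : MvPowerSeries Times2 (LaurentSeries ℂ)) : MvPowerSeries Times2 ℂ :=
  fun m => (MvPowerSeries.coeff m F).coeff 0

/-- `ξ(t_+ - t'_+, z)` in the local variable `w = z^{-1}` at `∞`. -/
def xiPlus : MvPowerSeries Times2 (LaurentSeries ℂ) := linSeries fun s => match s with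
  | Sum.inl (Sum.inl k) => wPow (-((k : ℕ) : ℤ))
  | Sum.inr (Sum.inl k) => -wPow (-((k : ℕ) : ℤ))
  | _ => 0

/-- `ξ(t'_- - t_-, z^{-1})` in the local variable `w = z` at `0`. -/
def xiMinus : MvPowerSeries Times2 (LaurentSeries ℂ) := linSeries fun s => match s with
  | Sum.inl (Sum.inr k) => -wPow (-((k : ℕ) : ℤ))
  | Sum.inr (Sum.inr k) => wPow (-((k : ℕ) : ℤ))
  | _ => 0

/-- The bilinear identity of the negative BKP hierarchy. -/
def NegativeBKP (f : MvPowerSeries Times ℂ) : Prop :=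
  contourIntegral (expSeries xiPlus * shift Sum.inl (-1) 0 f * shift Sum.inr 1 0 f) =
    contourIntegral (expSeries xiMinus * shift Sum.inl 0 1 f * shift Sum.inr 0 (-1) f)

/-! ### Hirota derivatives -/

/-- `(D_{s_1} ⋯ D_{s_r}) f · g`, where `D_s f · g = (∂_s - ∂'_s) f(t) g(t')|_{t' = t}`. -/
def hirota : List Times → MvPowerSeries Times ℂ → MvPowerSeries Times ℂ → MvPowerSeries Times ℂ
  | [], f, g => f * g
  | s :: l, f, g => hirota l (MvPowerSeries.pderiv ℂ s f) g - hirota l f (MvPowerSeries.pderiv ℂ s g)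

/-- The time `t_1`. -/
def t1 : Times := Sum.inl ⟨1, by decide⟩

/-- The time `t_3`. -/
def t3 : Times := Sum.inl ⟨3, by decide⟩

/-- The time `t_{-1}`. -/
def tm1 : Times := Sum.inr ⟨1, by decide⟩

/-- `D_{-1}(D_3 - D_1^3) f · f = 0`. -/
def FirstMember (f : MvPowerSeries Times ℂ) : Prop :=
  hirota [tm1, t3] f f - hirota [tm1, t1, t1, t1] f f = 0

end NegBKP

end

/-! The core is bosonisation for neutral fermions. Let `U = ⟨0|φ_0`, a bra killed by every `φ_n`
with `n > 0`, and let `w = z^{-1}`. The series `∑_n ⟨U|e^{H_+} φ_n G e^{H_-}|0⟩ w^{-n}` equals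
`e^{ξ(t_+, z)}` times `⟨U|φ_0 e^{H_+} G e^{H_-}|0⟩` with `t_+` replaced by `t_+ - [w]`. A mirror
formula, with `w = z` and `t_- + [w]`, describes the modes of `G φ_{-n}` on the ket. Now apply the
basic bilinear condition to the coefficients of `⟨U|e^{H_+}` and `e^{H_-}|0⟩`. The alternating sum
over `n` is the `w^0` coefficient of a product of two such series, and the sign `(-1)^n` is the
substitution `w ↦ -w`, which turns `[w]` into `-[w]`. One side produces `⟨0|φ_0 φ_0 = ½⟨0|`, the
other `⟨0|φ_0 … φ_0|0⟩`, which is `½ τ` (`matrixElement_zero`). Scaling `G` by 2 therefore expresses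
both sides through `τ`.

Bosonisation itself is proved by uniqueness (`eq_of_pderiv_eq`). Both sides satisfy the same first
order linear equations in the times, because `[H_k, ψ_m] = -ε ψ_{m-k}`. A derivative replaces `G` by
`H_k G` or `G H_{-k}`, so all bilinear forms are treated at once and no property of `G` is needed.
At time zero both sides are determined by a recursion in powers of `w`: `shiftCoeff_succ` for the
translated series, and `FermionRep.vacuum_recursion` for the modes. The latter rests on the fact
that the generating series of the modes `ψ_{-i}`, `i ≥ 0`, squares to `1/2`.

The zero mode identity holds because moving `φ_0` through an element of the Clifford algebra applies
the reflection fixing `φ_0` and negating all other modes. This reflection preserves the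
contractions, hence vacuum expectation values, and `φ_0² = 1/2`.

For the first member, apply `(∂_{-1} - ∂'_{-1})(∂_3 - ∂'_3)` to the bilinear identity and set `t' =
t`. The terms in which no derivative hits an exponential agree on both sides. What remains is a
`w^3` coefficient on the left, which contains `D_1^3` and `D_3`, and a `w^1` coefficient on the
right, which contains `D_{-1}`. This uses nothing but the bilinear identity. -/

noncomputable section

namespace NegBKP

/-! ### Chain rules and linear differential equations for formal power series -/

section ChainRule

variable {σ τ R S : Type} [CommRing R] [CommRing S] [Algebra R S]

/-- Continuity for the product topology on power series and discrete topologies on the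
coefficients. -/
def IsCoeffContinuous (L : MvPowerSeries σ R → S) : Prop :=
  letI : UniformSpace R := ⊥
  letI : UniformSpace S := ⊥
  letI := MvPowerSeries.WithPiTopology.instTopologicalSpace (σ := σ) R
  Continuous L

/-- A coefficient of a twisted derivation along a substitution vanishes if it is continuous, and if
it vanishes on an ideal that contains the values at the variables. -/
theorem coeff_twisted_derivation_eq_zero {a : σ → MvPowerSeries τ S} (ha : MvPowerSeries.HasSubst a)
    (Δ : MvPowerSeries σ R →ₗ[R] MvPowerSeries τ S)
    (hmul : ∀ f g, Δ (f * g) =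
      Δ f * MvPowerSeries.subst a g + MvPowerSeries.subst a f * Δ g)
    (I : Ideal (MvPowerSeries τ S)) (hX : ∀ s, Δ (MvPowerSeries.X s) ∈ I)
    (e : τ →₀ ℕ) (hI : ∀ x ∈ I, MvPowerSeries.coeff e x = 0)
    (hc : IsCoeffContinuous (fun f => MvPowerSeries.coeff e (Δ f)))
    (f : MvPowerSeries σ R) : MvPowerSeries.coeff e (Δ f) = 0 := by
  let : UniformSpace R := ⊥
  let : UniformSpace S := ⊥
  have : DiscreteTopology S := ⟨rfl⟩
  let := MvPowerSeries.WithPiTopology.instTopologicalSpace (σ := σ) R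
  have h1 : Δ 1 = 0 := by
    have h := hmul 1 1
    have h2 : MvPowerSeries.subst a (1 : MvPowerSeries σ R) = 1 := by
      rw [← MvPowerSeries.coe_substAlgHom ha, map_one]
    rw [h2] at h
    simpa using h
  -- Constants are killed, and a product lands in `I` as soon as the values of both factors do, so
  -- the values at the variables control all polynomials. Density and continuity of the chosen
  -- coefficient then reach all power series.
  have hp : ∀ p : MvPolynomial σ R, Δ (p : MvPowerSeries σ R) ∈ I := by
    intro p
    induction p using MvPolynomial.induction_on with
    | C r =>
      have : ((MvPolynomial.C r : MvPolynomial σ R) : MvPowerSeries σ R) = r • 1 := by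
        rw [MvPolynomial.coe_C, MvPowerSeries.smul_eq_C_mul, mul_one]
      rw [this, map_smul, h1, smul_zero]
      exact I.zero_mem
    | add p q hp hq =>
      rw [MvPolynomial.coe_add, map_add]
      exact I.add_mem hp hq
    | mul_X p s hp =>
      rw [MvPolynomial.coe_mul, hmul, MvPolynomial.coe_X]
      exact I.add_mem (I.mul_mem_right _ hp) (I.mul_mem_left _ (hX s))
  have hd := MvPowerSeries.WithPiTopology.denseRange_toMvPowerSeries (σ := σ) (R := R)
  have := DenseRange.equalizer hd hc (continuous_const (y := (0 : S)))
    (funext fun p => hI _ (hp p))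
  exact congrFun this f

theorem continuous_coeff_subst {a : σ → MvPowerSeries τ S} (ha : MvPowerSeries.HasSubst a)
    (e : τ →₀ ℕ) :
    IsCoeffContinuous (fun f : MvPowerSeries σ R => MvPowerSeries.coeff e (MvPowerSeries.subst a f)) := by
  let : UniformSpace R := ⊥
  let : UniformSpace S := ⊥
  have : DiscreteUniformity R := ⟨rfl⟩
  have : DiscreteUniformity S := ⟨rfl⟩
  let := MvPowerSeries.WithPiTopology.instTopologicalSpace (σ := σ) R
  let := MvPowerSeries.WithPiTopology.instTopologicalSpace (σ := τ) S
  exact (MvPowerSeries.WithPiTopology.continuous_coeff S e).comp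
    (MvPowerSeries.continuous_subst ha)

theorem continuous_pderiv (s : σ) :
    letI : UniformSpace R := ⊥
    letI := MvPowerSeries.WithPiTopology.instTopologicalSpace (σ := σ) R
    Continuous (MvPowerSeries.pderiv R s : MvPowerSeries σ R → MvPowerSeries σ R) := by
  let : UniformSpace R := ⊥
  have : DiscreteTopology R := ⟨rfl⟩
  let := MvPowerSeries.WithPiTopology.instTopologicalSpace (σ := σ) R
  refine continuous_pi fun d => ?_
  have : Continuous fun f : MvPowerSeries σ R =>
      MvPowerSeries.coeff (d + Finsupp.single s 1) f * (d s + 1) :=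
    (continuous_of_discreteTopology (f := fun x : R => x * (d s + 1))).comp
      (MvPowerSeries.WithPiTopology.continuous_coeff R _)
  convert this using 2 with f
  exact MvPowerSeries.coeff_pderiv f d

/-- The chain rule for a substitution in which `∂_u` differentiates the value of just one
variable `s`, up to terms in an ideal killed by the coefficient. -/
theorem coeff_pderiv_subst_sum {a : σ → MvPowerSeries τ S} (ha : MvPowerSeries.HasSubst a)
    (D : Derivation S (MvPowerSeries τ S) (MvPowerSeries τ S))
    (e : τ →₀ ℕ) (hDc : IsCoeffContinuous (fun f : MvPowerSeries σ R => MvPowerSeries.coeff e (D (MvPowerSeries.subst a f))))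
    (A : Finset σ) (c : σ → MvPowerSeries τ S)
    (hcc : ∀ s ∈ A, IsCoeffContinuous (fun f : MvPowerSeries σ R => MvPowerSeries.coeff e (c s * MvPowerSeries.subst a f)))
    (I : Ideal (MvPowerSeries τ S)) (hI : ∀ x ∈ I, MvPowerSeries.coeff e x = 0)
    (hA : ∀ s ∈ A, D (a s) = c s) (hA' : ∀ s ∉ A, D (a s) ∈ I) (f : MvPowerSeries σ R) :
    MvPowerSeries.coeff e (D (MvPowerSeries.subst a f)) =
      ∑ s ∈ A, MvPowerSeries.coeff e
        (c s * MvPowerSeries.subst a (MvPowerSeries.pderiv R s f)) := by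
  classical
  -- The defect between the two sides of the chain rule is a twisted derivation along the
  -- substitution, so only its values at the variables need to be checked: zero on `A`, in `I` off
  -- `A`.
  have key := coeff_twisted_derivation_eq_zero (R := R) ha
    { toFun := fun f => D (MvPowerSeries.subst a f) -
        ∑ s ∈ A, c s * MvPowerSeries.subst a (MvPowerSeries.pderiv R s f)
      map_add' := fun f g => by
        simp only [map_add, MvPowerSeries.subst_add ha, mul_add, Finset.sum_add_distrib]
        ring
      map_smul' := fun r f => by
        have h (x : MvPowerSeries σ R) : MvPowerSeries.subst a (r • x) =
            r • MvPowerSeries.subst a x := MvPowerSeries.subst_smul ha r x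
        have h' (x : MvPowerSeries τ S) : D (r • x) = r • D x := by
          rw [← algebraMap_smul S r x, Derivation.map_smul, algebraMap_smul]
        rw [h, h', RingHom.id_apply, smul_sub, Finset.smul_sum]
        congr 1
        refine Finset.sum_congr rfl fun s _ => ?_
        rw [Derivation.map_smul, h, mul_smul_comm] }
    (fun f g => by
      simp only [LinearMap.coe_mk, AddHom.coe_mk, MvPowerSeries.subst_mul ha,
        Derivation.leibniz, smul_eq_mul, MvPowerSeries.subst_add ha, sub_mul, mul_sub,
        Finset.mul_sum, Finset.sum_mul, mul_add, Finset.sum_add_distrib]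
      have h1 : ∀ s, c s * (MvPowerSeries.subst a f *
          MvPowerSeries.subst a (MvPowerSeries.pderiv R s g)) =
          MvPowerSeries.subst a f * (c s * MvPowerSeries.subst a (MvPowerSeries.pderiv R s g)) :=
        fun s => by ring
      have h2 : ∀ s, c s * (MvPowerSeries.subst a g *
          MvPowerSeries.subst a (MvPowerSeries.pderiv R s f)) =
          c s * MvPowerSeries.subst a (MvPowerSeries.pderiv R s f) * MvPowerSeries.subst a g :=
        fun s => by ring
      simp only [h1, h2]
      ring)
    I (fun s => by
      have h1 : MvPowerSeries.subst a (1 : MvPowerSeries σ R) = 1 := by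
        rw [← MvPowerSeries.coe_substAlgHom ha, map_one]
      have h0 : MvPowerSeries.subst a (0 : MvPowerSeries σ R) = 0 := by
        rw [← MvPowerSeries.coe_substAlgHom ha, map_zero]
      have h2 : ∑ s' ∈ A, c s' * MvPowerSeries.subst a
          (MvPowerSeries.pderiv R s' (MvPowerSeries.X s)) = if s ∈ A then c s else 0 := by
        rw [← Finset.sum_ite_eq A s c]
        refine Finset.sum_congr rfl fun s' _ => ?_
        split_ifs with h
        · subst h; simp [h1]
        · rw [MvPowerSeries.pderiv_X_of_ne h, h0, mul_zero]
      simp only [LinearMap.coe_mk, AddHom.coe_mk, MvPowerSeries.subst_X ha, h2]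
      split_ifs with h
      · rw [hA s h, sub_self]; exact I.zero_mem
      · rw [sub_zero]; exact hA' s h)
    e hI ?_ f
  · simpa [sub_eq_zero] using key
  · let : UniformSpace R := ⊥
    let : UniformSpace S := ⊥
    have : DiscreteTopology S := ⟨rfl⟩
    let := MvPowerSeries.WithPiTopology.instTopologicalSpace (σ := σ) R
    simp only [LinearMap.coe_mk, AddHom.coe_mk, map_sub, map_sum]
    exact hDc.sub (continuous_finsetSum A fun s hs => (hcc s hs).comp (continuous_pderiv s))

theorem continuous_coeff_mul_subst {a : σ → MvPowerSeries τ S} (ha : MvPowerSeries.HasSubst a)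
    (c : MvPowerSeries τ S) (e : τ →₀ ℕ) :
    IsCoeffContinuous (fun f : MvPowerSeries σ R => MvPowerSeries.coeff e (c * MvPowerSeries.subst a f)) := by
  classical
  let : UniformSpace R := ⊥
  let : UniformSpace S := ⊥
  have : DiscreteTopology S := ⟨rfl⟩
  let := MvPowerSeries.WithPiTopology.instTopologicalSpace (σ := σ) R
  simp only [MvPowerSeries.coeff_mul]
  exact continuous_finsetSum _ fun p _ => (continuous_coeff_subst ha p.2).const_mul _

/-- Since only finitely many of the values depend on `u`, the chain rule is an exact finite sum and
the zero ideal suffices. -/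
theorem pderiv_subst {a : σ → MvPowerSeries τ S} (ha : MvPowerSeries.HasSubst a) (u : τ)
    (A : Finset σ) (hA : ∀ s ∉ A, MvPowerSeries.pderiv S u (a s) = 0) (f : MvPowerSeries σ R) :
    MvPowerSeries.pderiv S u (MvPowerSeries.subst a f) =
      ∑ s ∈ A, MvPowerSeries.pderiv S u (a s) *
        MvPowerSeries.subst a (MvPowerSeries.pderiv R s f) := by
  ext e
  rw [map_sum]
  refine coeff_pderiv_subst_sum ha _ e ?_ A _ (fun s _ => continuous_coeff_mul_subst ha _ e) ⊥
    (fun x hx => by rw [Ideal.mem_bot.1 hx, map_zero]) (fun _ _ => rfl)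
    (fun s hs => by rw [hA s hs]; exact Ideal.zero_mem _) f
  let : UniformSpace R := ⊥
  let : UniformSpace S := ⊥
  have : DiscreteTopology S := ⟨rfl⟩
  let := MvPowerSeries.WithPiTopology.instTopologicalSpace (σ := σ) R
  simp only [MvPowerSeries.coeff_pderiv]
  exact (continuous_coeff_subst ha _).mul_const _

/-- Uniqueness for linear first order differential equations, for a family of series whose members
are permuted by the derivatives. -/
theorem eq_of_pderiv_eq {ι : Type*} [IsAddTorsionFree S] (P Q : ι → MvPowerSeries σ S)
    (α : σ → S) (act : σ → ι → ι)
    (h0 : ∀ i, MvPowerSeries.constantCoeff (P i) = MvPowerSeries.constantCoeff (Q i))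
    (hP : ∀ s i, MvPowerSeries.pderiv S s (P i) = α s • P i + P (act s i))
    (hQ : ∀ s i, MvPowerSeries.pderiv S s (Q i) = α s • Q i + Q (act s i)) (i : ι) :
    P i = Q i := by
  ext m
  -- The equation in direction `s` expresses the coefficient at `d + e_s`, times `d s + 1`, through
  -- coefficients at `d`. The index `i` moves under `act`, so it is generalised; torsion-freeness
  -- removes the factor.
  induction hn : m.degree using Nat.strong_induction_on generalizing m i with
  | _ n ih =>
    by_cases hm : m = 0
    · subst hm
      simpa using h0 i
    · obtain ⟨s, hs⟩ := Finsupp.support_nonempty_iff.2 hm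
      obtain ⟨d, rfl⟩ : ∃ d, m = d + Finsupp.single s 1 := by
        refine ⟨m - Finsupp.single s 1, (tsub_add_cancel_of_le ?_).symm⟩
        rw [Finsupp.single_le_iff]
        exact Nat.one_le_iff_ne_zero.2 (Finsupp.mem_support_iff.1 hs)
      have hd : d.degree < n := by
        rw [map_add, Finsupp.degree_single] at hn
        omega
      have h1 := congrArg (MvPowerSeries.coeff d) (hP s i)
      have h2 := congrArg (MvPowerSeries.coeff d) (hQ s i)
      simp only [MvPowerSeries.coeff_pderiv, map_add, map_smul, ih _ hd _ d rfl] at h1 h2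
      have h3 := h1.trans h2.symm
      have h4 : ((d s : S) + 1) = ((d s + 1 : ℕ) : S) := by push_cast; rfl
      rw [h4, mul_comm, ← nsmul_eq_mul, mul_comm, ← nsmul_eq_mul,
        smul_right_inj (Nat.succ_ne_zero _)] at h3
      exact h3

theorem pderiv_comm (s u : σ) (f : MvPowerSeries σ R) :
    MvPowerSeries.pderiv R s (MvPowerSeries.pderiv R u f) =
      MvPowerSeries.pderiv R u (MvPowerSeries.pderiv R s f) := by
  classical
  ext d
  simp only [MvPowerSeries.coeff_pderiv, Finsupp.add_apply]
  by_cases h : s = u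
  · subst h; rfl
  · rw [add_right_comm d, Finsupp.single_eq_of_ne (fun h' => h h'.symm),
      Finsupp.single_eq_of_ne h]
    simp only [add_zero]
    ring

end ChainRule

/-! ### Shifted series -/

/-- The odd numbers up to `n`. -/
def oddsUpTo (n : ℕ) : Finset Odds := (Finset.range (n + 1)).subtype Odd

theorem mem_oddsUpTo (n : ℕ) (k : Odds) : k ∈ oddsUpTo n ↔ (k : ℕ) ≤ n := by
  simp [oddsUpTo]

/-- The degree `k` of the times `t_k` and `t_{-k}`. -/
def level : Times → ℕ := Sum.elim (fun k => k) (fun k => k)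

/-- The numbers `cp` at the times `t_k` and `cm` at the times `t_{-k}`. -/
def sgn (cp cm : ℂ) : Times → ℂ := Sum.elim (fun _ => cp) (fun _ => cm)

theorem level_pos (s : Times) : 0 < level s := by
  rcases s with k | k <;> exact k.2.pos

theorem level_odd (s : Times) : Odd (level s) := by
  rcases s with k | k <;> exact k.2

theorem shiftVar_eq (e : Times → Times2) (cp cm : ℂ) (s : Times) :
    shiftVar e cp cm s = MvPowerSeries.X (some (e s)) +
      (sgn cp cm s * (2 / (level s : ℂ))) • MvPowerSeries.X none ^ level s := by
  rcases s with k | k <;> rfl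

theorem pderiv_some_shiftVar (e : Times → Times2) (cp cm : ℂ) (s : Times) (u : Times2) :
    MvPowerSeries.pderiv ℂ (some u) (shiftVar e cp cm s) =
      MvPowerSeries.pderiv ℂ (some u) (MvPowerSeries.X (some (e s))) := by
  rw [shiftVar_eq, map_add, Derivation.map_smul, MvPowerSeries.pderiv_pow,
    MvPowerSeries.pderiv_X_of_ne (j := none) (Option.some_ne_none u).symm, mul_zero, smul_zero,
    add_zero]

theorem pderiv_none_shiftVar (e : Times → Times2) (cp cm : ℂ) (s : Times) :
    MvPowerSeries.pderiv ℂ none (shiftVar e cp cm s) =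
      (2 * sgn cp cm s) • MvPowerSeries.X none ^ (level s - 1) := by
  have h : (level s : ℂ) ≠ 0 := by exact_mod_cast (level_pos s).ne'
  rw [shiftVar_eq, map_add, Derivation.map_smul, MvPowerSeries.pderiv_pow,
    MvPowerSeries.pderiv_X_of_ne (by simp), MvPowerSeries.pderiv_X_self, zero_add, mul_one,
    ← nsmul_eq_mul, ← Nat.cast_smul_eq_nsmul ℂ, smul_smul]
  congr 1
  field_simp

theorem pderiv_some_subst_shiftVar (e : Times → Times2) (he : Function.Injective e) (cp cm : ℂ)
    (s : Times) (f : MvPowerSeries Times ℂ) :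
    MvPowerSeries.pderiv ℂ (some (e s)) (MvPowerSeries.subst (shiftVar e cp cm) f) =
      MvPowerSeries.subst (shiftVar e cp cm) (MvPowerSeries.pderiv ℂ s f) := by
  rw [pderiv_subst (shiftVar_hasSubst e he cp cm) (some (e s)) {s}, Finset.sum_singleton,
    pderiv_some_shiftVar, MvPowerSeries.pderiv_X_self, one_mul]
  intro s' hs'
  rw [pderiv_some_shiftVar, MvPowerSeries.pderiv_X_of_ne]
  simpa [he.eq_iff] using hs'

theorem pderiv_some_subst_shiftVar_of_notMem (e : Times → Times2) (he : Function.Injective e)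
    (cp cm : ℂ) (u : Times2) (hu : u ∉ Set.range e) (f : MvPowerSeries Times ℂ) :
    MvPowerSeries.pderiv ℂ (some u) (MvPowerSeries.subst (shiftVar e cp cm) f) = 0 := by
  rw [pderiv_subst (shiftVar_hasSubst e he cp cm) (some u) ∅, Finset.sum_empty]
  intro s' _
  rw [pderiv_some_shiftVar, MvPowerSeries.pderiv_X_of_ne]
  exact fun h => hu ⟨s', Option.some_injective _ h⟩

/-- The coefficient of `w^n` in `f(cp [w], cm [w])`. -/
def shiftCoeff (e : Times → Times2) (cp cm : ℂ) (n : ℕ) (f : MvPowerSeries Times ℂ) : ℂ :=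
  MvPowerSeries.coeff (Finsupp.single none n) (MvPowerSeries.subst (shiftVar e cp cm) f)

theorem constantCoeff_subst_of_constantCoeff_eq_zero {σ τ R S : Type} [CommRing R] [CommRing S]
    [Algebra R S] {a : σ → MvPowerSeries τ S} (ha : MvPowerSeries.HasSubst a)
    (h0 : ∀ s, MvPowerSeries.constantCoeff (a s) = 0) (f : MvPowerSeries σ R) :
    MvPowerSeries.constantCoeff (MvPowerSeries.subst a f) =
      algebraMap R S (MvPowerSeries.constantCoeff f) := by
  rw [MvPowerSeries.constantCoeff_subst ha, finsum_eq_single _ 0]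
  · simp [Algebra.smul_def]
  · intro d hd
    obtain ⟨i, hi⟩ := Finsupp.support_nonempty_iff.2 hd
    rw [Finsupp.prod, map_prod, Finset.prod_eq_zero hi, smul_zero]
    rw [map_pow, h0, zero_pow (Finsupp.mem_support_iff.1 hi)]

theorem shiftCoeff_zero (e : Times → Times2) (he : Function.Injective e) (cp cm : ℂ)
    (f : MvPowerSeries Times ℂ) :
    shiftCoeff e cp cm 0 f = MvPowerSeries.constantCoeff f := by
  rw [shiftCoeff, Finsupp.single_zero, MvPowerSeries.coeff_zero_eq_constantCoeff_apply,
    constantCoeff_subst_of_constantCoeff_eq_zero (shiftVar_hasSubst e he cp cm)]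
  · rfl
  · intro s
    simp [shiftVar_eq, (level_pos s).ne']

/-- This is `w d/dw` of `f(cp [w], cm [w])`: the entry `2 w^k / k` of `[w]` differentiates to `2
w^{k-1}`, so each odd `k` contributes a derivative of `f` with the power of `w` lowered by `k`. -/
theorem shiftCoeff_succ (e : Times → Times2) (he : Function.Injective e) (cp cm : ℂ) (n : ℕ)
    (f : MvPowerSeries Times ℂ) :
    (n : ℂ) * shiftCoeff e cp cm n f =
      2 * ∑ k ∈ oddsUpTo n,
        (cp * shiftCoeff e cp cm (n - k) (MvPowerSeries.pderiv ℂ (Sum.inl k) f) +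
          cm * shiftCoeff e cp cm (n - k) (MvPowerSeries.pderiv ℂ (Sum.inr k) f)) := by
  classical
  rcases n with _ | n
  · have : oddsUpTo 0 = ∅ := by
      ext k
      have := k.2.pos
      simp only [mem_oddsUpTo, Finset.notMem_empty, iff_false]
      omega
    simp [this]
  have hs := shiftVar_hasSubst e he cp cm
  have hlev : ∀ s : Times, s ∈ (oddsUpTo (n + 1)).disjSum (oddsUpTo (n + 1)) ↔
      level s ≤ n + 1 := by
    rintro (k | k) <;> simp [mem_oddsUpTo, level]
  have key := coeff_pderiv_subst_sum hs (MvPowerSeries.pderiv ℂ none) (Finsupp.single none n)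
    ?_ ((oddsUpTo (n + 1)).disjSum (oddsUpTo (n + 1)))
    (fun s => (2 * sgn cp cm s) • MvPowerSeries.X none ^ (level s - 1))
    (fun s _ => continuous_coeff_mul_subst hs _ _)
    -- All infinitely many shifted variables depend on `w`. Those of level above `n + 1` have
    -- `w`-derivative divisible by `w^{n+1}`, hence invisible to the coefficient of `w^n`; this
    -- leaves a finite sum.
    (Ideal.span {MvPowerSeries.X none ^ (n + 1)}) ?_
    (fun s _ => pderiv_none_shiftVar e cp cm s) ?_ f
  · have hterm : ∀ s : Times, level s ≤ n + 1 → ∀ g : MvPowerSeries Times ℂ,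
        MvPowerSeries.coeff (Finsupp.single none n)
          ((2 * sgn cp cm s) • MvPowerSeries.X none ^ (level s - 1) *
            MvPowerSeries.subst (shiftVar e cp cm) g) =
          2 * (sgn cp cm s * shiftCoeff e cp cm (n + 1 - level s) g) := by
      intro s hs g
      have h1 := level_pos s
      have h2 : Finsupp.single (none : Option Times2) (level s - 1) ≤ Finsupp.single none n := by
        rw [Finsupp.single_le_single]
        omega
      rw [smul_mul_assoc, map_smul, MvPowerSeries.X_pow_eq, MvPowerSeries.coeff_monomial_mul,
        if_pos h2, one_mul, smul_eq_mul, ← Finsupp.single_tsub, mul_assoc, shiftCoeff]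
      congr 5
      omega
    rw [MvPowerSeries.coeff_pderiv, Finsupp.single_eq_same, ← Finsupp.single_add,
      Finset.sum_congr rfl fun s hs => hterm s ((hlev s).1 hs) _, Finset.sum_disjSum] at key
    rw [Finset.sum_add_distrib, mul_add, Finset.mul_sum, Finset.mul_sum, mul_comm, shiftCoeff]
    push_cast
    exact key
  · let : UniformSpace ℂ := ⊥
    have : DiscreteTopology ℂ := ⟨rfl⟩
    let := MvPowerSeries.WithPiTopology.instTopologicalSpace (σ := Times) ℂ
    simp only [MvPowerSeries.coeff_pderiv]
    exact (continuous_of_discreteTopology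
      (f := fun x : ℂ => x * ((Finsupp.single (none : Option Times2) n) none + 1))).comp
        (continuous_coeff_subst hs _)
  · intro x hx
    obtain ⟨y, rfl⟩ := Ideal.mem_span_singleton'.1 hx
    rw [mul_comm, MvPowerSeries.X_pow_eq, MvPowerSeries.coeff_monomial_mul, if_neg]
    rw [Finsupp.single_le_single]
    omega
  · intro s hs
    rw [hlev] at hs
    rw [pderiv_none_shiftVar]
    obtain ⟨d, hd⟩ : ∃ d, level s - 1 = d + (n + 1) := ⟨level s - 1 - (n + 1), by omega⟩
    rw [hd, pow_add _ d, ← smul_mul_assoc]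
    exact Ideal.mul_mem_left _ _ (Ideal.subset_span rfl)

theorem coeff_toLaurent {σ : Type} (f : MvPowerSeries (Option σ) ℂ) (m : σ →₀ ℕ) :
    MvPowerSeries.coeff m (toLaurent f) = HahnSeries.ofPowerSeries ℤ ℂ
      (PowerSeries.mk fun n => MvPowerSeries.coeff (m.optionElim n) f) := rfl

theorem optionElim_add_single {σ : Type} (m : σ →₀ ℕ) (u : σ) (n : ℕ) :
    (m + Finsupp.single u 1).optionElim n = m.optionElim n + Finsupp.single (some u) 1 := by
  classical
  ext (_ | v)
  · simp
  · simp [Finsupp.single_apply]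

theorem pderiv_toLaurent {σ : Type} (f : MvPowerSeries (Option σ) ℂ) (u : σ) :
    MvPowerSeries.pderiv (LaurentSeries ℂ) u (toLaurent f) =
      toLaurent (MvPowerSeries.pderiv ℂ (some u) f) := by
  ext1 m
  rw [MvPowerSeries.coeff_pderiv, coeff_toLaurent, coeff_toLaurent]
  have h : ((m u : LaurentSeries ℂ) + 1) =
      HahnSeries.ofPowerSeries ℤ ℂ (PowerSeries.C ((m u : ℂ) + 1)) := by
    simp
  rw [h, ← map_mul]
  congr 1
  ext n
  rw [PowerSeries.coeff_mul_C, PowerSeries.coeff_mk, PowerSeries.coeff_mk,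
    MvPowerSeries.coeff_pderiv, optionElim_add_single, Finsupp.optionElim_apply_some]

theorem pderiv_shift (e : Times → Times2) (he : Function.Injective e) (cp cm : ℂ)
    (s : Times) (f : MvPowerSeries Times ℂ) :
    MvPowerSeries.pderiv (LaurentSeries ℂ) (e s) (shift e cp cm f) =
      shift e cp cm (MvPowerSeries.pderiv ℂ s f) := by
  rw [shift, pderiv_toLaurent, pderiv_some_subst_shiftVar e he, shift]

theorem pderiv_shift_of_notMem (e : Times → Times2) (he : Function.Injective e) (cp cm : ℂ)
    (u : Times2) (hu : u ∉ Set.range e) (f : MvPowerSeries Times ℂ) :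
    MvPowerSeries.pderiv (LaurentSeries ℂ) u (shift e cp cm f) = 0 := by
  rw [shift, pderiv_toLaurent, pderiv_some_subst_shiftVar_of_notMem e he cp cm u hu]
  ext1 m
  rw [coeff_toLaurent]
  simp only [map_zero]
  exact map_zero (HahnSeries.ofPowerSeries ℤ ℂ)

theorem constantCoeff_shift (e : Times → Times2) (cp cm : ℂ) (f : MvPowerSeries Times ℂ) :
    MvPowerSeries.constantCoeff (shift e cp cm f) =
      HahnSeries.ofPowerSeries ℤ ℂ (PowerSeries.mk fun n => shiftCoeff e cp cm n f) := by
  rw [← MvPowerSeries.coeff_zero_eq_constantCoeff_apply, shift, coeff_toLaurent]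
  congr 2

/-! ### The exponential of a linear series -/

theorem pderiv_linSeries {σ R : Type} [CommRing R] (c : σ → R) (u : σ) :
    MvPowerSeries.pderiv R u (linSeries c) = MvPowerSeries.C (c u) := by
  classical
  ext m
  rw [MvPowerSeries.coeff_pderiv, MvPowerSeries.coeff_C]
  change (∑ s ∈ (m + Finsupp.single u 1).support,
    if m + Finsupp.single u 1 = Finsupp.single s 1 then c s else 0) * _ = _
  by_cases hm : m = 0
  · subst hm
    rw [if_pos rfl, zero_add, Finsupp.support_single _ one_ne_zero]
    simp
  · rw [if_neg hm, Finset.sum_eq_zero, zero_mul]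
    intro s _
    rw [if_neg]
    intro h
    apply hm
    have h1 := congrArg Finsupp.degree h
    rw [map_add, Finsupp.degree_single, Finsupp.degree_single] at h1
    exact (Finsupp.degree_eq_zero_iff m).1 (by omega)

theorem constantCoeff_linSeries {σ R : Type} [CommRing R] (c : σ → R) :
    MvPowerSeries.constantCoeff (linSeries c) = 0 := by
  rw [← MvPowerSeries.coeff_zero_eq_constantCoeff_apply]
  change linSeries c 0 = 0
  simp [linSeries]

theorem pderiv_expSeries {σ : Type} (c : σ → LaurentSeries ℂ) (u : σ) :
    MvPowerSeries.pderiv (LaurentSeries ℂ) u (expSeries (linSeries c)) =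
      c u • expSeries (linSeries c) := by
  have h := pderiv_subst (R := ℂ) (PowerSeries.HasSubst.const (linSeries_hasSubst c)) u
    Finset.univ (fun s hs => absurd (Finset.mem_univ s) hs) (PowerSeries.exp ℂ)
  have h2 : MvPowerSeries.pderiv ℂ () (PowerSeries.exp ℂ) = PowerSeries.exp ℂ :=
    PowerSeries.derivative_exp ℂ
  rw [expSeries, PowerSeries.subst, h, Fintype.sum_unique, pderiv_linSeries,
    MvPowerSeries.smul_eq_C_mul]
  change _ * MvPowerSeries.subst _ (MvPowerSeries.pderiv ℂ () (PowerSeries.exp ℂ)) = _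
  rw [h2]

theorem constantCoeff_expSeries {σ : Type} (c : σ → LaurentSeries ℂ) :
    MvPowerSeries.constantCoeff (expSeries (linSeries c)) = 1 := by
  rw [expSeries, PowerSeries.subst, constantCoeff_subst_of_constantCoeff_eq_zero
    (PowerSeries.HasSubst.const (linSeries_hasSubst c)) fun _ => constantCoeff_linSeries c]
  have : MvPowerSeries.constantCoeff (PowerSeries.exp ℂ) = 1 := PowerSeries.constantCoeff_exp
  rw [this, map_one]

/-! ### Representations of the neutral fermions -/

/-- A space on which neutral fermions act by operators `ψ_n`, every vector being annihilated by
`ψ_n` for all large `n`, with the odd modes `H_k` of the current multiplied by `ε`. -/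
structure FermionRep (E : Type) [AddCommGroup E] [Module ℂ E] where
  psi : ℤ → E →ₗ[ℂ] E
  H : Odds → E →ₗ[ℂ] E
  ε : ℂ
  ε_mul_self : ε * ε = 1
  psi_psi : ∀ m n v, psi m (psi n v) = anti m n • v - psi n (psi m v)
  bdd : ∀ v, ∃ N : ℤ, 0 ≤ N ∧ ∀ n > N, psi n v = 0
  H_apply : ∀ k v, H k v =
    (ε / 2) • ∑ᶠ i : ℤ, ((-1 : ℂ) ^ (i + 1)) • psi (-i - (k : ℕ)) (psi i v)

namespace FermionRep

variable {E : Type} [AddCommGroup E] [Module ℂ E] (F : FermionRep E)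

/-- For large `i` the inner mode kills `v`. For very negative `i` the other mode does, after
exchanging the two; they anticommute because `n ≠ 0`. -/
theorem current_finite (n : ℤ) (hn : n ≠ 0) (v : E) :
    (Function.support fun i : ℤ =>
      ((-1 : ℂ) ^ (i + 1)) • F.psi (-i - n) (F.psi i v)).Finite := by
  obtain ⟨N, hN, h⟩ := F.bdd v
  refine (Set.finite_Icc (-N - |n|) N).subset fun i hi => ?_
  have a1 := le_abs_self n
  have a2 := neg_le_abs n
  by_contra hc
  refine hi ?_
  rw [Set.mem_Icc, not_and_or, not_le, not_le] at hc
  rcases hc with hc | hc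
  · simp only [F.psi_psi (-i - n) i, anti_of_ne (-i - n) i (by omega), h (-i - n) (by omega)]
    simp
  · simp only [h i (by omega)]
    simp

theorem neg_one_zpow_add_one (n : ℤ) : (-1 : ℂ) ^ (n + 1) = -(-1) ^ n := by
  rw [zpow_add_one₀ (by norm_num)]
  ring

theorem neg_one_zpow_mul_self (n : ℤ) : (-1 : ℂ) ^ n * (-1) ^ n = 1 := by
  rw [← mul_zpow]
  norm_num

theorem neg_one_zpow_add_odd (n : ℤ) (k : Odds) : (-1 : ℂ) ^ (n + (k : ℕ)) = -(-1) ^ n := by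
  rw [zpow_add₀ (by norm_num), zpow_natCast, k.2.neg_one_pow]
  ring

theorem neg_one_zpow_sub_odd (n : ℤ) (k : Odds) : (-1 : ℂ) ^ (n - (k : ℕ)) = -(-1) ^ n := by
  have h := neg_one_zpow_add_odd (n - (k : ℕ)) k
  rw [sub_add_cancel] at h
  rw [h, neg_neg]

/-- `[H_k, ψ_m] = -ε ψ_{m-k}`. -/
theorem H_psi (k : Odds) (m : ℤ) (v : E) :
    F.H k (F.psi m v) = F.psi m (F.H k v) - F.ε • F.psi (m - (k : ℕ)) v := by
  have hk := k.ne_zero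
  -- Moving `ψ_m` past the two fermions leaves one contraction at `i = -m` and one at `i = m - k`.
  -- They contribute equally, which cancels the `1/2` in the current.
  have hterm : ∀ i : ℤ, ((-1 : ℂ) ^ (i + 1)) • F.psi (-i - (k : ℕ)) (F.psi i (F.psi m v)) =
      F.psi m (((-1 : ℂ) ^ (i + 1)) • F.psi (-i - (k : ℕ)) (F.psi i v)) +
        ((if i = -m then -F.psi (m - (k : ℕ)) v else 0) +
          (if i = m - (k : ℕ) then -F.psi (m - (k : ℕ)) v else 0)) := by
    intro i
    rw [F.psi_psi i m, map_sub, map_smul, F.psi_psi (-i - (k : ℕ)) m, map_smul, smul_sub,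
      smul_sub, smul_smul, smul_smul]
    have h1 : ((-1 : ℂ) ^ (i + 1) * anti i m) • F.psi (-i - (k : ℕ)) v =
        if i = -m then -F.psi (m - (k : ℕ)) v else 0 := by
      split_ifs with h
      · subst h
        rw [anti, if_pos rfl, neg_one_zpow_add_one, neg_mul, neg_one_zpow_mul_self, neg_smul,
          one_smul, neg_neg]
      · rw [anti_of_ne i m h, mul_zero, zero_smul]
    have h2 : ((-1 : ℂ) ^ (i + 1) * anti (-i - (k : ℕ)) m) • F.psi i v =
        -if i = m - (k : ℕ) then -F.psi (m - (k : ℕ)) v else 0 := by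
      split_ifs with h
      · subst h
        rw [anti, if_pos (by ring), neg_one_zpow_add_one, neg_one_zpow_sub_odd, neg_neg,
          show -(m - ((k : ℕ) : ℤ)) - ((k : ℕ) : ℤ) = -m by ring, negOne_zpow_neg,
          neg_one_zpow_mul_self, one_smul, neg_neg]
      · rw [anti_of_ne _ _ (by omega), mul_zero, zero_smul, neg_zero]
    rw [h1, h2]
    abel
  have hsingle : ∀ (a : ℤ) (x : E), (∑ᶠ i : ℤ, if i = a then x else 0) = x := by
    intro a x
    rw [finsum_eq_single _ a (fun i hi => if_neg hi), if_pos rfl]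
  have hfin : ∀ (a : ℤ) (x : E), (Function.support fun i : ℤ => if i = a then x else 0).Finite := by
    intro a x
    refine (Set.finite_singleton a).subset fun i hi => ?_
    by_contra h
    exact hi (if_neg h)
  have hm : (Function.support fun i : ℤ =>
      F.psi m (((-1 : ℂ) ^ (i + 1)) • F.psi (-i - (k : ℕ)) (F.psi i v))).Finite := by
    refine (F.current_finite k hk v).subset fun i hi h => hi ?_
    beta_reduce at h ⊢
    rw [h, map_zero]
  rw [F.H_apply, F.H_apply, finsum_congr hterm, finsum_add_distrib hm
    (((hfin _ _).union (hfin _ _)).subset (Function.support_add _ _)),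
    finsum_add_distrib (hfin _ _) (hfin _ _), hsingle, hsingle, map_smul,
    map_finsum (F.psi m) (F.current_finite k hk v), smul_add, sub_eq_add_neg]
  module

/-- The operators `H_k` commute. -/
theorem H_comm (k l : Odds) (v : E) : F.H k (F.H l v) = F.H l (F.H k v) := by
  have hk := k.ne_zero
  have hl := l.ne_zero
  have hkl : ((k : ℕ) : ℤ) + (l : ℕ) ≠ 0 := by
    have := k.2.pos
    omega
  set f : ℤ → E := fun i =>
    ((-1 : ℂ) ^ (i + 1)) • F.psi (-i - (((k : ℕ) : ℤ) + (l : ℕ))) (F.psi i v) with hf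
  have hfin : (Function.support f).Finite := F.current_finite _ hkl v
  -- The commutator with the summand of `H_l` is a difference `f (i - k) - f i`, whose sum over `i`
  -- vanishes. As `k + l ≠ 0`, the function `f` has finite support and no central term arises.
  have hterm : ∀ i : ℤ, F.H k (((-1 : ℂ) ^ (i + 1)) • F.psi (-i - (l : ℕ)) (F.psi i v)) =
      ((-1 : ℂ) ^ (i + 1)) • F.psi (-i - (l : ℕ)) (F.psi i (F.H k v)) +
        F.ε • (f (i - (k : ℕ)) - f i) := by
    intro i
    have e1 : f i = ((-1 : ℂ) ^ (i + 1)) • F.psi (-i - (l : ℕ) - (k : ℕ)) (F.psi i v) := by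
      simp only [hf]
      congr 3
      ring
    have e2 : f (i - (k : ℕ)) =
        -(((-1 : ℂ) ^ (i + 1)) • F.psi (-i - (l : ℕ)) (F.psi (i - (k : ℕ)) v)) := by
      simp only [hf]
      rw [show i - ((k : ℕ) : ℤ) + 1 = (i + 1) - (k : ℕ) by ring, neg_one_zpow_sub_odd, neg_smul,
        show -(i - ((k : ℕ) : ℤ)) - (((k : ℕ) : ℤ) + (l : ℕ)) = -i - (l : ℕ) by ring]
    rw [map_smul, H_psi, H_psi, map_sub, map_smul, e1, e2]
    module
  have hshift : (∑ᶠ i : ℤ, f (i - (k : ℕ))) = ∑ᶠ i : ℤ, f i :=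
    finsum_comp_equiv (Equiv.subRight ((k : ℕ) : ℤ))
  have hfin' : (Function.support fun i : ℤ => f (i - (k : ℕ))).Finite :=
    (hfin.preimage (Equiv.subRight ((k : ℕ) : ℤ)).injective.injOn)
  have hsub : (Function.support fun i : ℤ => f (i - (k : ℕ)) - f i).Finite :=
    (hfin'.union hfin).subset (Function.support_sub _ _)
  rw [F.H_apply l v, map_smul, map_finsum (F.H k) (F.current_finite l hl v), finsum_congr hterm,
    finsum_add_distrib (F.current_finite l hl _), F.H_apply l (F.H k v)]
  · rw [← smul_finsum' _ hsub, finsum_sub_distrib hfin' hfin, hshift, sub_self, smul_zero, add_zero]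
  · refine hsub.subset fun i hi h => hi ?_
    beta_reduce at h ⊢
    rw [h, smul_zero]

/-! The exponential of the current. -/

/-- Each application of the current raises the degree in the times by one, so exactly one term of
the exponential series contributes to a given coefficient. -/
theorem current_iterate_const (v : E) (N : ℕ) (m : Odds →₀ ℕ) (hm : m.degree ≠ N) :
    (current F.H)^[N] (Series.const v) m = 0 := by
  induction N generalizing m with
  | zero =>
    have : m ≠ 0 := fun h => hm (by rw [h, map_zero])
    simp [Series.const, this]
  | succ N ih =>
    rw [Function.iterate_succ_apply', current]
    refine Finset.sum_eq_zero fun k hk => ?_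
    have h1 : Finsupp.single k 1 ≤ m := by
      rw [Finsupp.single_le_iff]
      exact Nat.one_le_iff_ne_zero.2 (Finsupp.mem_support_iff.1 hk)
    have h2 : (m - Finsupp.single k 1).degree + 1 = m.degree := by
      have := congrArg Finsupp.degree (tsub_add_cancel_of_le h1)
      simpa using this
    rw [ih _ (by omega), map_zero]

theorem expCurrent_const (v : E) (m : Odds →₀ ℕ) :
    expCurrent F.H (Series.const v) m =
      ((m.degree ! : ℂ)⁻¹) • (current F.H)^[m.degree] (Series.const v) m := by
  rw [expCurrent, Finset.sum_eq_single m.degree]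
  · intro N _ hN
    rw [F.current_iterate_const v N m hN.symm, smul_zero]
  · intro h
    simp at h

theorem expCurrent_zero (v : E) : expCurrent F.H (Series.const v) 0 = v := by
  simp [expCurrent_const, Series.const]

/-- Coefficient form of `∂_k A^{N+1} = (N+1) H_k A^N` for `A = ∑ t_k H_k`, which holds because the
`H_k` commute. The induction peels off one factor `H_l`; the case `l = k` is separated because there
the exponent of `t_k` changes. -/
theorem current_iterate_add_single (v : E) (m : Odds →₀ ℕ) (k : Odds) :
    ((m k : ℂ) + 1) • (current F.H)^[m.degree + 1] (Series.const v) (m + Finsupp.single k 1) =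
      ((m.degree : ℂ) + 1) • F.H k ((current F.H)^[m.degree] (Series.const v) m) := by
  classical
  induction hn : m.degree generalizing m with
  | zero =>
    obtain rfl : m = 0 := (Finsupp.degree_eq_zero_iff m).1 hn
    simp [current]
  | succ n ih =>
    have hsub : ∀ l ∈ m.support, ∃ d : Odds →₀ ℕ, m = d + Finsupp.single l 1 ∧ d.degree = n := by
      intro l hl
      have h1 : Finsupp.single l 1 ≤ m := by
        rw [Finsupp.single_le_iff]
        exact Nat.one_le_iff_ne_zero.2 (Finsupp.mem_support_iff.1 hl)
      have h2 := tsub_add_cancel_of_le h1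
      refine ⟨m - Finsupp.single l 1, h2.symm, ?_⟩
      have h3 := congrArg Finsupp.degree h2
      simp only [map_add, Finsupp.degree_single] at h3
      omega
    set W := (current F.H)^[n + 1] (Series.const v) with hW
    set W' := (current F.H)^[n] (Series.const v) with hW'
    have hWm : ∑ l ∈ m.support, F.H l (W' (m - Finsupp.single l 1)) = W m := by
      rw [hW, Function.iterate_succ_apply']
      rfl
    have hterm : ∀ l ∈ m.support, l ≠ k →
        ((m k : ℂ) + 1) • F.H l (W (m + Finsupp.single k 1 - Finsupp.single l 1)) =
          ((n : ℂ) + 1) • F.H k (F.H l (W' (m - Finsupp.single l 1))) := by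
      intro l hl hlk
      obtain ⟨d, rfl, hd⟩ := hsub l hl
      rw [add_right_comm, add_tsub_cancel_right, add_tsub_cancel_right, Finsupp.add_apply,
        Finsupp.single_eq_of_ne hlk.symm, add_zero, ← map_smul, ih d hd, map_smul, F.H_comm]
    have hkm : ((n : ℂ) + 1) • F.H k (if k ∈ m.support then F.H k (W' (m - Finsupp.single k 1))
        else 0) = (m k : ℂ) • F.H k (W m) := by
      split_ifs with hks
      · obtain ⟨d, rfl, hd⟩ := hsub k hks
        rw [add_tsub_cancel_right, ← map_smul, ← ih d hd, map_smul]
        simp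
      · rw [Finsupp.notMem_support_iff.1 hks]
        simp
    have hsupp : (m + Finsupp.single k 1).support = insert k (m.support.erase k) := by
      ext l
      by_cases h : l = k
      · subst h; simp
      · simp [h]
    have hsplit : ∑ l ∈ m.support.erase k, F.H l (W' (m - Finsupp.single l 1)) =
        W m - if k ∈ m.support then F.H k (W' (m - Finsupp.single k 1)) else 0 := by
      rw [← hWm]
      split_ifs with hks
      · rw [← Finset.sum_erase_add _ _ hks, add_sub_cancel_right]
      · rw [Finset.erase_eq_of_notMem hks, sub_zero]
    rw [Function.iterate_succ_apply', current, hsupp, Finset.sum_insert (Finset.notMem_erase _ _),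
      add_tsub_cancel_right, smul_add, Finset.smul_sum,
      Finset.sum_congr rfl fun l hl => hterm l (Finset.mem_of_mem_erase hl)
        (Finset.ne_of_mem_erase hl), ← Finset.smul_sum, ← map_sum, hsplit, map_sub, smul_sub, hkm]
    push_cast
    module

/-- `∂_k e^{∑ t_k H_k} v = H_k e^{∑ t_k H_k} v`. -/
theorem expCurrent_add_single (v : E) (m : Odds →₀ ℕ) (k : Odds) :
    ((m k : ℂ) + 1) • expCurrent F.H (Series.const v) (m + Finsupp.single k 1) =
      F.H k (expCurrent F.H (Series.const v) m) := by
  rw [expCurrent_const, expCurrent_const, map_add, Finsupp.degree_single, smul_comm,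
    current_iterate_add_single, map_smul, smul_smul, Nat.factorial_succ]
  congr 1
  have h1 : (m.degree : ℂ) + 1 ≠ 0 := by exact_mod_cast Nat.succ_ne_zero m.degree
  have h2 : (m.degree ! : ℂ) ≠ 0 := by exact_mod_cast Nat.factorial_ne_zero m.degree
  push_cast
  field_simp

end FermionRep

/-- Counts the identical commutator terms `-ε ψ_{-n} v`, one for each odd `k ≤ n`, that appear in
`FermionRep.vacuum_recursion`. -/
theorem two_mul_card_oddsUpTo (n : ℕ) :
    2 * (oddsUpTo n).card = n + if Odd n then 1 else 0 := by
  rw [oddsUpTo, Finset.card_subtype]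
  induction n with
  | zero => decide
  | succ n ih =>
    rw [Finset.range_add_one, Finset.filter_insert]
    by_cases h : Odd n
    · have h' : ¬ Odd (n + 1) := by simpa [parity_simps] using h
      rw [if_neg h', if_neg h', ih, if_pos h]
    · have h' : Odd (n + 1) := by simpa [parity_simps] using h
      rw [if_pos h', if_pos h', Finset.card_insert_of_notMem (by simp), mul_add, ih, if_neg h]

/-! ### Action of the currents on a vacuum -/

namespace FermionRep

variable {E : Type} [AddCommGroup E] [Module ℂ E] (F : FermionRep E)

/-- The generating series of the operators `ψ_{-i}`, `i ≥ 0`. -/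
def genSeries : PowerSeries (Module.End ℂ E) := PowerSeries.mk fun i => F.psi (-(i : ℤ))

/-- The generating series of the operators `ψ_{-i}`, `i ≥ 0` odd. -/
def oddSeries : PowerSeries (Module.End ℂ E) :=
  PowerSeries.mk fun i => if Odd i then F.psi (-(i : ℤ)) else 0

theorem psi_mul_psi (m n : ℤ) :
    F.psi m * F.psi n + F.psi n * F.psi m = anti m n • (1 : Module.End ℂ E) := by
  ext v
  simp only [LinearMap.add_apply, Module.End.mul_apply, LinearMap.smul_apply, Module.End.one_apply]
  rw [F.psi_psi m n v, sub_add_cancel]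

theorem sum_antidiagonal_swap {M : Type} [AddCommMonoid M] (n : ℕ) (f : ℕ → ℕ → M) :
    ∑ p ∈ Finset.HasAntidiagonal.antidiagonal n, f p.1 p.2 = ∑ p ∈ Finset.HasAntidiagonal.antidiagonal n, f p.2 p.1 :=
  (Finset.Nat.sum_antidiagonal_swap (f := fun p => f p.1 p.2)).symm

/-- The modes `ψ_{-i}`, `i ≥ 0`, anticommute except that `ψ_0² = 1/2`; after symmetrising the Cauchy
product only the constant term survives. -/
theorem genSeries_mul_self : F.genSeries * F.genSeries + F.genSeries * F.genSeries = 1 := by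
  ext1 n
  rw [map_add, PowerSeries.coeff_mul]
  nth_rewrite 2 [sum_antidiagonal_swap n fun i j =>
    PowerSeries.coeff i F.genSeries * PowerSeries.coeff j F.genSeries]
  rw [← Finset.sum_add_distrib, PowerSeries.coeff_one]
  simp only [genSeries, PowerSeries.coeff_mk, psi_mul_psi]
  split_ifs with h
  · subst h
    simp [anti]
  · refine Finset.sum_eq_zero fun p hp => ?_
    rw [Finset.HasAntidiagonal.mem_antidiagonal] at hp
    rw [anti_of_ne _ _ (by omega), zero_smul]

/-- The odd series omits the zero mode, the only nonpositive mode with a nonzero square, so all the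
anticommutators vanish. -/
theorem genSeries_mul_oddSeries :
    F.genSeries * F.oddSeries = -(F.oddSeries * F.genSeries) := by
  rw [eq_neg_iff_add_eq_zero]
  ext1 n
  rw [map_add, PowerSeries.coeff_mul, PowerSeries.coeff_mul,
    sum_antidiagonal_swap n fun i j =>
      PowerSeries.coeff i F.oddSeries * PowerSeries.coeff j F.genSeries,
    ← Finset.sum_add_distrib, map_zero]
  simp only [genSeries, oddSeries, PowerSeries.coeff_mk]
  refine Finset.sum_eq_zero fun p hp => ?_
  split_ifs with h
  · have := h.pos
    rw [psi_mul_psi, anti_of_ne _ _ (by omega), zero_smul]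
  · simp

/-- By anticommutation the commutator is `2 ψ χ`, with `ψ` the full and `χ` the odd series, and `ψ²
= 1/2` removes the leading factor. -/
theorem genSeries_mul_commutator :
    F.genSeries * (F.genSeries * F.oddSeries - F.oddSeries * F.genSeries) = F.oddSeries := by
  have h1 : F.oddSeries * F.genSeries = -(F.genSeries * F.oddSeries) := by
    rw [genSeries_mul_oddSeries, neg_neg]
  rw [h1, sub_neg_eq_add, mul_add, ← mul_assoc, ← add_mul, genSeries_mul_self, one_mul]

/-- Identifies the alternating sign in the current with the coefficient of `ψ_{-a} ψ_{-b}` in the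
commutator of the full and the odd series. -/
theorem neg_one_zpow_of_odd_add {a b : ℕ} (h : Odd (a + b)) :
    (-1 : ℂ) ^ (-(b : ℤ) + 1) = (if Odd b then 1 else 0) - if Odd a then 1 else 0 := by
  rw [neg_one_zpow_add_one, negOne_zpow_neg, zpow_natCast]
  by_cases hb : Odd b
  · have ha : ¬ Odd a := by
      intro ha
      exact (Nat.not_odd_iff_even.2 (ha.add_odd hb)) h
    rw [if_pos hb, if_neg ha, hb.neg_one_pow]
    norm_num
  · have ha : Odd a := by
      by_contra ha
      rw [Nat.not_odd_iff_even] at ha hb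
      exact (Nat.not_odd_iff_even.2 (ha.add hb)) h
    rw [if_neg hb, if_pos ha, (Nat.not_odd_iff_even.1 hb).neg_one_pow]
    norm_num

theorem coeff_commutator (n : ℕ) :
    PowerSeries.coeff n (F.genSeries * F.oddSeries - F.oddSeries * F.genSeries) =
      ∑ p ∈ Finset.HasAntidiagonal.antidiagonal n, (((if Odd p.2 then 1 else 0) - if Odd p.1 then 1 else 0) : ℂ) •
        (F.psi (-(p.1 : ℤ)) * F.psi (-(p.2 : ℤ))) := by
  rw [map_sub, PowerSeries.coeff_mul, PowerSeries.coeff_mul, ← Finset.sum_sub_distrib]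
  refine Finset.sum_congr rfl fun p _ => ?_
  simp only [genSeries, oddSeries, PowerSeries.coeff_mk]
  split_ifs <;> simp

theorem coeff_commutator_of_even (n : ℕ) (hn : ¬ Odd n) :
    PowerSeries.coeff n (F.genSeries * F.oddSeries - F.oddSeries * F.genSeries) = 0 := by
  rw [coeff_commutator]
  refine Finset.sum_eq_zero fun p hp => ?_
  rw [Finset.HasAntidiagonal.mem_antidiagonal] at hp
  have : Odd p.1 ↔ Odd p.2 := by
    rw [← hp, Nat.odd_add] at hn
    rw [Nat.even_iff, Nat.odd_iff] at *
    grind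
  simp only [this, sub_self, zero_smul]

/-- On a vacuum only the summands with `-k ≤ i ≤ 0` survive: they are products of two nonpositive
modes of total index `-k`, hence coefficients of products of the generating series. -/
theorem H_vacuum {v : E} (hv : ∀ n > 0, F.psi n v = 0) (k : Odds) :
    F.H k v = (F.ε / 2) •
      (PowerSeries.coeff (k : ℕ) (F.genSeries * F.oddSeries - F.oddSeries * F.genSeries)) v := by
  rw [F.H_apply, coeff_commutator, LinearMap.sum_apply]
  congr 1
  have hinj : Set.InjOn (fun p : ℕ × ℕ => -(p.2 : ℤ)) (Finset.HasAntidiagonal.antidiagonal (k : ℕ)) := by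
    rintro ⟨a, b⟩ h ⟨c, d⟩ h' e
    simp only [Finset.mem_coe, Finset.HasAntidiagonal.mem_antidiagonal] at h h' e
    ext <;> simp <;> omega
  rw [finsum_eq_sum_of_support_subset (s := (Finset.HasAntidiagonal.antidiagonal (k : ℕ)).image
    fun p : ℕ × ℕ => -(p.2 : ℤ)), Finset.sum_image hinj]
  · refine Finset.sum_congr rfl fun p hp => ?_
    rw [Finset.HasAntidiagonal.mem_antidiagonal] at hp
    rw [LinearMap.smul_apply, Module.End.mul_apply, ← neg_one_zpow_of_odd_add (hp ▸ k.2)]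
    congr 3
    omega
  · intro i hi
    by_contra hc
    refine hi ?_
    have hc' : 0 < i ∨ i < -((k : ℕ) : ℤ) := by
      by_contra h
      rw [not_or, not_lt, not_lt] at h
      refine hc ?_
      rw [Finset.coe_image]
      exact ⟨((i + (k : ℕ)).toNat, (-i).toNat), by simp; omega, by simp; omega⟩
    beta_reduce
    rcases hc' with h | h
    · rw [hv i h, map_zero, smul_zero]
    · have := k.2.pos
      rw [F.psi_psi, hv (-i - (k : ℕ)) (by omega), anti_of_ne _ _ (by omega)]
      simp

/-- The modes `ψ_{-n} v` of a vacuum `v` obey the recursion of the coefficients of the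
exponential of the currents. -/
theorem vacuum_recursion {v : E} (hv : ∀ n > 0, F.psi n v = 0) (n : ℕ) :
    (n : ℂ) • F.psi (-(n : ℤ)) v =
      (-2 * F.ε) • ∑ k ∈ oddsUpTo n, F.H k (F.psi (-((n - k : ℕ) : ℤ)) v) := by
  set B := F.genSeries * F.oddSeries - F.oddSeries * F.genSeries with hB
  have hterm : ∀ k ∈ oddsUpTo n, F.H k (F.psi (-((n - k : ℕ) : ℤ)) v) =
      (F.ε / 2) • F.psi (-((n - k : ℕ) : ℤ)) (PowerSeries.coeff (k : ℕ) B v) -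
        F.ε • F.psi (-(n : ℤ)) v := by
    intro k hk
    rw [mem_oddsUpTo] at hk
    rw [F.H_psi, F.H_vacuum hv, map_smul]
    congr 4
    omega
  -- This is the coefficient of index `n` in `genSeries_mul_commutator`. The even coefficients of
  -- the commutator vanish, so restricting to odd `k` loses nothing.
  have hsum : ∑ k ∈ oddsUpTo n, F.psi (-((n - k : ℕ) : ℤ)) (PowerSeries.coeff (k : ℕ) B v) =
      (if Odd n then (1 : ℂ) else 0) • F.psi (-(n : ℤ)) v := by
    rw [oddsUpTo, Finset.sum_subtype_eq_sum_filter (s := Finset.range (n + 1))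
      (f := fun k : ℕ => F.psi (-((n - k : ℕ) : ℤ)) (PowerSeries.coeff k B v)),
      Finset.sum_filter_of_ne]
    · have h1 := congrArg (fun x : PowerSeries (Module.End ℂ E) => (PowerSeries.coeff n x) v) F.genSeries_mul_commutator
      simp only [← hB, PowerSeries.coeff_mul, LinearMap.sum_apply, Module.End.mul_apply] at h1
      rw [sum_antidiagonal_swap n fun i j =>
          (PowerSeries.coeff i F.genSeries) ((PowerSeries.coeff j B) v),
        Finset.Nat.sum_antidiagonal_eq_sum_range_succ fun i j =>
          (PowerSeries.coeff j F.genSeries) ((PowerSeries.coeff i B) v)] at h1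
      simp only [genSeries, oddSeries, PowerSeries.coeff_mk] at h1
      rw [h1]
      split_ifs <;> simp
    · intro k _ hk
      by_contra h
      refine hk ?_
      rw [hB, F.coeff_commutator_of_even k h]
      simp
  have hcard : (2 : ℂ) * (oddsUpTo n).card = n + if Odd n then 1 else 0 := by
    have := two_mul_card_oddsUpTo n
    split_ifs at this ⊢ <;> exact_mod_cast this
  rw [Finset.sum_congr rfl hterm, Finset.sum_sub_distrib, ← Finset.smul_sum, hsum,
    Finset.sum_const, ← Nat.cast_smul_eq_nsmul ℂ, smul_smul, smul_smul, ← sub_smul, smul_smul]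
  congr 1
  linear_combination (-F.ε * F.ε) * hcard + (-(n : ℂ)) * F.ε_mul_self

end FermionRep

/-- `F_B^*` with the right action of the fermions. -/
def leftRep : FermionRep FockL where
  psi n := actL (phi n)
  H := hPlus
  ε := 1
  ε_mul_self := one_mul 1
  psi_psi m n v := by rw [actL_anticomm n m, anti_comm]
  bdd := actL_bdd
  H_apply k v := by
    change (1 / 2 : ℂ) • ∑ᶠ i : ℤ, ((-1 : ℂ) ^ (i + 1)) • actL (phi i * phi (-i - (k : ℕ))) v = _
    simp only [actL_mul]

/-- `F_B` with the action of the fermions, their indices being reversed. -/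
def rightRep : FermionRep FockR where
  psi n := actR (phi (-n))
  H := hMinus
  ε := -1
  ε_mul_self := by norm_num
  psi_psi m n v := by
    rw [actR_anticomm (-m) (-n)]
    congr 2
    unfold anti
    simp only [negOne_zpow_neg, neg_inj]
  bdd v := by
    obtain ⟨N, hN, h⟩ := actR_bdd v
    exact ⟨N, hN, fun n hn => h _ (by omega)⟩
  H_apply k v := by
    change (1 / 2 : ℂ) • ∑ᶠ i : ℤ, ((-1 : ℂ) ^ (i + 1)) •
      actR (phi i * phi (-i - -((k : ℕ) : ℤ))) v = _
    -- Shifting the summation index by the odd number `k` brings the current to the form required by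
    -- `FermionRep` and flips its sign; this is why `ε = -1` here.
    rw [← finsum_comp_equiv (Equiv.addRight ((k : ℕ) : ℤ)), neg_div, neg_smul, ← smul_neg,
      ← finsum_neg_distrib]
    congr 1
    refine finsum_congr fun i => ?_
    rw [Equiv.coe_addRight, add_right_comm, FermionRep.neg_one_zpow_add_odd, neg_smul, actR_mul]
    congr 6 <;> ring

/-! ### The zero mode -/

/-- The reflection of `W_B` that fixes `φ_0` and negates the other `φ_n`. -/
def refl : W →ₗ[ℂ] W :=
  Finsupp.linearCombination ℂ fun n =>
    if n = 0 then (Finsupp.single n 1 : W) else -Finsupp.single n 1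

theorem refl_single (n : ℤ) : refl (Finsupp.single n 1) =
    if n = 0 then (Finsupp.single n 1 : W) else -Finsupp.single n 1 := by
  simp [refl]

/-- The hypothesis says that `φ_0` is paired with no other mode, so the signs introduced by the
reflection cancel in pairs. -/
theorem bil_refl (c : ℤ → ℤ → ℂ) (hc : ∀ m n, c m n ≠ 0 → (m = 0 ↔ n = 0)) :
    (bil c).compl₁₂ refl refl = bil c := by
  ext m n
  simp only [LinearMap.comp_apply, Finsupp.lsingle_apply, LinearMap.compl₁₂_apply, refl_single,
    bil_single]
  have h := hc m n
  by_cases h0 : c m n = 0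
  · split_ifs <;> simp [bil_single, h0]
  · have := h h0
    split_ifs <;> first | (exfalso; tauto) | simp [bil_single]

theorem bil_contr_refl (v w : W) : bil contr (refl v) (refl w) = bil contr v w := by
  have h := bil_refl contr fun m n h => by
    unfold contr at h
    split_ifs at h <;> first | omega | exact absurd rfl h
  exact congrArg (fun B : LinearMap.BilinForm ℂ W => B v w) h

theorem bil_anti_refl (v w : W) : bil anti (refl v) (refl w) = bil anti v w := by
  have h := bil_refl anti fun m n h => by
    unfold anti at h
    split_ifs at h <;> first | omega | exact absurd rfl h
  exact congrArg (fun B : LinearMap.BilinForm ℂ W => B v w) h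

/-- The reflection as an isometry of `Q`. -/
def reflIsometry : Q →qᵢ Q :=
  { refl with
    map_app' := fun v => by
      change Q (refl v) = Q v
      simp only [Q, smul_apply, LinearMap.BilinMap.toQuadraticMap_apply,
        bil_anti_refl] }

/-- The automorphism of `Cl(W_B)` that fixes `φ_0` and negates the other `φ_n`. -/
def reflAlg : Cl →ₐ[ℂ] Cl := CliffordAlgebra.map reflIsometry

theorem reflAlg_ι (v : W) :
    reflAlg (CliffordAlgebra.ι Q v) = CliffordAlgebra.ι Q (refl v) :=
  CliffordAlgebra.map_apply_ι reflIsometry v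

theorem contractLeft_map_refl (d : Module.Dual ℂ W) (y : ExteriorAlgebra ℂ W) :
    CliffordAlgebra.contractLeft d (ExteriorAlgebra.map refl y) =
      ExteriorAlgebra.map refl (CliffordAlgebra.contractLeft (d ∘ₗ refl) y) := by
  have hι (v : W) : ExteriorAlgebra.map refl (CliffordAlgebra.ι 0 v) =
      CliffordAlgebra.ι 0 (refl v) := ExteriorAlgebra.map_apply_ι refl v
  induction y using CliffordAlgebra.left_induction with
  | algebraMap r =>
    rw [AlgHom.commutes, CliffordAlgebra.contractLeft_algebraMap,
      CliffordAlgebra.contractLeft_algebraMap, map_zero]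
  | add x y hx hy => simp only [map_add, hx, hy]
  | ι_mul x v hx =>
    rw [map_mul, hι, CliffordAlgebra.contractLeft_ι_mul, CliffordAlgebra.contractLeft_ι_mul,
      hx, map_sub, map_smul, map_mul, hι]
    rfl

theorem normalOrder_ι_mul (v : W) (x : Cl) : normalOrder (CliffordAlgebra.ι Q v * x) =
    ExteriorAlgebra.ι ℂ v * normalOrder x +
      CliffordAlgebra.contractLeft (bil contr v) (normalOrder x) := by
  rw [normalOrder, CliffordAlgebra.changeForm_ι_mul]
  simp [ExteriorAlgebra.ι]

/-- Normal ordering is built from exterior multiplication and the contractions, and the reflection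
is compatible with both. -/
theorem normalOrder_reflAlg (x : Cl) :
    normalOrder (reflAlg x) = ExteriorAlgebra.map refl (normalOrder x) := by
  induction x using CliffordAlgebra.left_induction with
  | algebraMap r =>
    rw [AlgHom.commutes, normalOrder, CliffordAlgebra.changeForm_algebraMap]
    exact (AlgHom.commutes _ _).symm
  | add x y hx hy => simp only [map_add, hx, hy]
  | ι_mul x v hx =>
    have h : bil contr (refl v) ∘ₗ refl = bil contr v :=
      LinearMap.ext fun w => bil_contr_refl v w
    rw [map_mul, reflAlg_ι, normalOrder_ι_mul, normalOrder_ι_mul, hx, map_add, map_mul,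
      ExteriorAlgebra.map_apply_ι, contractLeft_map_refl, h]

theorem vev_reflAlg (x : Cl) : vev (reflAlg x) = vev x := by
  have h : (ExteriorAlgebra.algebraMapInv (R := ℂ) (M := W)).comp (ExteriorAlgebra.map refl) =
      ExteriorAlgebra.algebraMapInv := by
    ext v
    simp [ExteriorAlgebra.algebraMapInv]
  have h' := congrArg (fun g : ExteriorAlgebra ℂ W →ₐ[ℂ] ℂ => g (normalOrder x)) h
  simp only [vev, LinearMap.comp_apply, normalOrder_reflAlg]
  exact h'

theorem phi_zero_mul_phi_zero : phi 0 * phi 0 = algebraMap ℂ Cl (1 / 2) := by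
  have h := phi_anticomm 0 0
  rw [← two_smul ℂ, anti, if_pos (neg_zero).symm, zpow_zero] at h
  calc phi 0 * phi 0 = ((1 / 2 : ℂ) * 2) • (phi 0 * phi 0) := by norm_num
    _ = algebraMap ℂ Cl (1 / 2) := by rw [mul_smul, h, Algebra.smul_def, ← map_mul, mul_one]

theorem phi_zero_mul_phi (n : ℤ) (hn : n ≠ 0) : phi 0 * phi n = -(phi n * phi 0) := by
  have h := phi_anticomm 0 n
  rw [anti_of_ne _ _ (by omega), map_zero] at h
  exact eq_neg_of_add_eq_zero_left h

theorem phi_zero_mul (x : Cl) : phi 0 * x = reflAlg x * phi 0 := by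
  induction x using CliffordAlgebra.left_induction with
  | algebraMap r => rw [AlgHom.commutes, Algebra.commutes]
  | add x y hx hy => rw [mul_add, hx, hy, map_add, add_mul]
  | ι_mul x v hx =>
    have key : phi 0 * CliffordAlgebra.ι Q v = CliffordAlgebra.ι Q (refl v) * phi 0 := by
      induction v using Finsupp.induction_linear with
      | zero => simp
      | add p q hp hq => simp only [map_add, mul_add, add_mul, hp, hq]
      | single n c =>
        have e : (Finsupp.single n c : W) = c • Finsupp.single n 1 := by simp
        rw [e, map_smul, map_smul, map_smul, mul_smul_comm, smul_mul_assoc, refl_single]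
        congr 1
        split_ifs with h
        · subst h; rfl
        · rw [map_neg, neg_mul]
          exact phi_zero_mul_phi n h
    rw [← mul_assoc, key, mul_assoc, hx, ← mul_assoc, map_mul, reflAlg_ι]

/-- Moving the left `φ_0` through `x` reflects `x` and yields `φ_0² = 1/2`; the expectation value
does not see the reflection. -/
theorem vev_phi_zero_mul_mul_phi_zero (x : Cl) : vev (phi 0 * x * phi 0) = (1 / 2) * vev x := by
  rw [phi_zero_mul, mul_assoc, phi_zero_mul_phi_zero, ← Algebra.commutes, ← Algebra.smul_def,
    map_smul, vev_reflAlg, smul_eq_mul]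

/-- Left multiplication by `φ_0` on `F_B^*`. -/
def zeroL : FockL →ₗ[ℂ] FockL := cre.mapQ cre (LinearMap.mulLeft ℂ (phi 0)) (by
  refine Submodule.span_le.2 ?_
  rintro _ ⟨x, n, hn, rfl⟩
  change phi 0 * (phi n * x) ∈ cre
  rw [← mul_assoc, phi_zero_mul_phi n hn.ne', neg_mul, mul_assoc]
  exact cre.neg_mem (Submodule.subset_span ⟨_, n, hn, rfl⟩))

/-- Right multiplication by `φ_0` on `F_B`. -/
def zeroR : FockR →ₗ[ℂ] FockR := ann.mapQ ann (LinearMap.mulRight ℂ (phi 0)) (by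
  refine Submodule.span_le.2 ?_
  rintro _ ⟨x, n, hn, rfl⟩
  change x * phi n * phi 0 ∈ ann
  rw [mul_assoc, ← neg_eq_iff_eq_neg.2 (phi_zero_mul_phi n hn.ne), mul_neg, ← mul_assoc]
  exact ann.neg_mem (Submodule.subset_span ⟨_, n, hn, rfl⟩))

theorem zeroL_actL (a : Cl) (v : FockL) : zeroL (actL a v) = actL a (zeroL v) := by
  obtain ⟨x, rfl⟩ := Submodule.Quotient.mk_surjective _ v
  exact congrArg braOf (mul_assoc (phi 0) x a).symm

theorem zeroR_actR (a : Cl) (v : FockR) : zeroR (actR a v) = actR a (zeroR v) := by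
  obtain ⟨x, rfl⟩ := Submodule.Quotient.mk_surjective _ v
  exact congrArg ketOf (mul_assoc a x (phi 0))

namespace FermionRep

variable {E : Type} [AddCommGroup E] [Module ℂ E] (F : FermionRep E)

theorem map_H (T : E →ₗ[ℂ] E) (hT : ∀ n v, T (F.psi n v) = F.psi n (T v)) (k : Odds) (v : E) :
    T (F.H k v) = F.H k (T v) := by
  rw [F.H_apply, F.H_apply, map_smul, map_finsum T (F.current_finite k k.ne_zero v)]
  simp only [map_smul, hT]

/-- An operator commuting with all fermions commutes with the currents and their exponential. The
cases of interest are multiplication by `φ_0` on the outer side of a vector, and scalars. -/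
theorem map_expCurrent (T : E →ₗ[ℂ] E) (hT : ∀ n v, T (F.psi n v) = F.psi n (T v)) (v : E)
    (m : Odds →₀ ℕ) :
    T (expCurrent F.H (Series.const v) m) = expCurrent F.H (Series.const (T v)) m := by
  have key (N : ℕ) : ∀ m, T ((current F.H)^[N] (Series.const v) m) =
      (current F.H)^[N] (Series.const (T v)) m := by
    induction N with
    | zero =>
      intro m
      simp only [Function.iterate_zero, id_eq, Series.const]
      split_ifs <;> simp
    | succ N ih =>
      intro m
      simp only [Function.iterate_succ_apply', current, map_sum, F.map_H T hT, ih]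
  rw [expCurrent_const, expCurrent_const, map_smul, key]

end FermionRep

/-- A single Clifford element represents `G` on both pairs of vectors, which reduces the claim to
expectation values. This is where membership of `G` in the completion is used. -/
theorem fermionic_zero {G : Op} (hG : IsFermionic G) (U : FockL) (V : FockR) :
    G (zeroL U) (zeroR V) = (1 / 2) * G U V := by
  classical
  obtain ⟨a, ha⟩ := hG {(zeroL U, zeroR V), (U, V)}
  have h1 := ha (zeroL U, zeroR V) (by simp)
  have h2 := ha (U, V) (by simp)
  simp only at h1 h2
  rw [h1, h2]
  obtain ⟨x, rfl⟩ := Submodule.Quotient.mk_surjective _ U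
  obtain ⟨y, rfl⟩ := Submodule.Quotient.mk_surjective _ V
  change vev (phi 0 * x * (a * (y * phi 0))) = (1 / 2) * vev (x * (a * y))
  rw [← vev_phi_zero_mul_mul_phi_zero]
  congr 1
  simp only [mul_assoc]

theorem matrixElement_zero {G : Op} (hG : IsFermionic G) (U : FockL) (V : FockR) :
    matrixElement G (zeroL U) (zeroR V) = (1 / 2 : ℂ) • matrixElement G U V := by
  funext m
  change G (expCurrent leftRep.H (Series.const (zeroL U)) _)
    (expCurrent rightRep.H (Series.const (zeroR V)) _) = (1 / 2) * G (expCurrent leftRep.H _ _)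
    (expCurrent rightRep.H _ _)
  rw [← leftRep.map_expCurrent zeroL fun n v => zeroL_actL _ _,
    ← rightRep.map_expCurrent zeroR fun n v => zeroR_actR _ _, fermionic_zero hG]

/-! ### Derivatives of matrix elements -/

theorem sumEquiv_add_inl {α β : Type} (m : α ⊕ β →₀ ℕ) (k : α) :
    Finsupp.sumFinsuppEquivProdFinsupp (m + Finsupp.single (Sum.inl k) 1) =
      ((Finsupp.sumFinsuppEquivProdFinsupp m).1 + Finsupp.single k 1,
        (Finsupp.sumFinsuppEquivProdFinsupp m).2) := by
  classical
  ext x <;> simp [Finsupp.single_apply]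

theorem sumEquiv_add_inr {α β : Type} (m : α ⊕ β →₀ ℕ) (k : β) :
    Finsupp.sumFinsuppEquivProdFinsupp (m + Finsupp.single (Sum.inr k) 1) =
      ((Finsupp.sumFinsuppEquivProdFinsupp m).1,
        (Finsupp.sumFinsuppEquivProdFinsupp m).2 + Finsupp.single k 1) := by
  classical
  ext x <;> simp [Finsupp.single_apply]

/-- The operator `H_k G`, respectively `G H_{-k}`, for the time `t_k`, respectively `t_{-k}`. -/
def actOp : Times → Op → Op
  | Sum.inl k, G => G ∘ₗ hPlus k
  | Sum.inr k, G => G.compl₂ (hMinus k)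

/-- The current produced by the derivative stands next to `G` and is absorbed into it, so for fixed
`U` and `V` the matrix elements of all operators form a family closed under derivatives. -/
theorem pderiv_matrixElement (s : Times) (G : Op) (U : FockL) (V : FockR) :
    MvPowerSeries.pderiv ℂ s (matrixElement G U V) = matrixElement (actOp s G) U V := by
  ext m
  rw [MvPowerSeries.coeff_pderiv]
  rcases s with k | k
  · change G (braExp U _) (ketExp V _) * _ = G (hPlus k (braExp U _)) (ketExp V _)
    rw [sumEquiv_add_inl]
    have h := leftRep.expCurrent_add_single U (Finsupp.sumFinsuppEquivProdFinsupp m).1 k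
    change _ • braExp U _ = hPlus k (braExp U _) at h
    rw [← h, map_smul, LinearMap.smul_apply, smul_eq_mul, mul_comm]
    simp
  · change G (braExp U _) (ketExp V _) * _ = G (braExp U _) (hMinus k (ketExp V _))
    rw [sumEquiv_add_inr]
    have h := rightRep.expCurrent_add_single V (Finsupp.sumFinsuppEquivProdFinsupp m).2 k
    change _ • ketExp V _ = hMinus k (ketExp V _) at h
    rw [← h, map_smul, smul_eq_mul, mul_comm]
    simp

/-! ### Generating series of modes -/

/-- The series `∑_n q_n w^{-n}`, if each of its coefficients has finitely many terms with
`n > 0`. -/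
def modeSeries (q : ℤ → MvPowerSeries Times ℂ) : MvPowerSeries Times (LaurentSeries ℂ) :=
  open Classical in fun m =>
    -- The default value 0 is never reached for modes satisfying `ModesBdd`.
    if h : BddBelow (Function.support fun n : ℤ => MvPowerSeries.coeff m (q (-n))) then
      HahnSeries.ofSuppBddBelow _ h else 0

/-- The modes `q_n` vanish for large `n`, coefficientwise. -/
def ModesBdd (q : ℤ → MvPowerSeries Times ℂ) : Prop :=
  ∀ m, ∃ N : ℤ, ∀ n > N, MvPowerSeries.coeff m (q n) = 0

theorem coeff_modeSeries {q : ℤ → MvPowerSeries Times ℂ} (hq : ModesBdd q) (m : Times →₀ ℕ)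
    (n : ℤ) : (MvPowerSeries.coeff m (modeSeries q)).coeff n = MvPowerSeries.coeff m (q (-n)) := by
  have h : BddBelow (Function.support fun n : ℤ => MvPowerSeries.coeff m (q (-n))) := by
    obtain ⟨N, hN⟩ := hq m
    refine ⟨-N, fun n hn => ?_⟩
    by_contra hc
    exact hn (hN (-n) (by omega))
  change (modeSeries q m).coeff n = _
  rw [modeSeries, dif_pos h, HahnSeries.coeff_ofSuppBddBelow]

theorem smul_wPow (c : ℂ) (l : ℤ) : c • wPow l = HahnSeries.single l c := by
  ext m
  rw [HahnSeries.coeff_smul, wPow]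
  simp [HahnSeries.coeff_single]

theorem coeff_smul_wPow_mul (c : ℂ) (l : ℤ) (x : LaurentSeries ℂ) (n : ℤ) :
    (((c • wPow l) * x : LaurentSeries ℂ)).coeff n = c * x.coeff (n - l) := by
  have := HahnSeries.coeff_single_mul_add (r := c) (x := x) (a := n - l) (b := l)
  rw [sub_add_cancel] at this
  rw [smul_wPow, this]

instance : IsAddTorsionFree (LaurentSeries ℂ) where
  nsmul_right_injective n hn x y h := by
    ext m
    have h' := congrArg (fun z : LaurentSeries ℂ => z.coeff m) h
    simp only [HahnSeries.coeff_nsmul, Pi.smul_apply] at h'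
    exact (smul_right_inj hn).1 h'

theorem natCast_add_one_coeff (x : LaurentSeries ℂ) (a : ℕ) (n : ℤ) :
    (x * ((a : LaurentSeries ℂ) + 1)).coeff n = x.coeff n * ((a : ℂ) + 1) := by
  have h : ((a : LaurentSeries ℂ) + 1) = HahnSeries.C ((a : ℂ) + 1) := by
    rw [map_add, map_natCast, map_one]
  rw [h, mul_comm, HahnSeries.C_mul_eq_smul, HahnSeries.coeff_smul, smul_eq_mul, mul_comm]

/-- Lowering the mode index by `l` multiplies the generating series by `w^{-l}`; thus a commutator
with a current becomes the derivative of an exponential prefactor. -/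
theorem pderiv_modeSeries {q q' : ℤ → MvPowerSeries Times ℂ} (hq : ModesBdd q)
    (hq' : ModesBdd q') (s : Times) (c : ℂ) (l : ℤ)
    (h : ∀ n, MvPowerSeries.pderiv ℂ s (q n) = c • q (n - l) + q' n) :
    MvPowerSeries.pderiv (LaurentSeries ℂ) s (modeSeries q) =
      (c • wPow (-l)) • modeSeries q + modeSeries q' := by
  ext m n
  rw [MvPowerSeries.coeff_pderiv, natCast_add_one_coeff, coeff_modeSeries hq, map_add,
    HahnSeries.coeff_add, coeff_modeSeries hq', map_smul, smul_eq_mul, coeff_smul_wPow_mul,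
    coeff_modeSeries hq, ← MvPowerSeries.coeff_pderiv, h, map_add, map_smul, smul_eq_mul]
  congr 4
  ring

/-! ### Products in two sets of times -/

/-- The product of a series in the unprimed and a series in the primed times. -/
def tensor {R : Type} [CommRing R] (f g : MvPowerSeries Times R) : MvPowerSeries Times2 R :=
  fun m => MvPowerSeries.coeff (Finsupp.sumFinsuppEquivProdFinsupp m).1 f *
    MvPowerSeries.coeff (Finsupp.sumFinsuppEquivProdFinsupp m).2 g

theorem coeff_tensor {R : Type} [CommRing R] (f g : MvPowerSeries Times R) (m : Times2 →₀ ℕ) :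
    MvPowerSeries.coeff m (tensor f g) =
      MvPowerSeries.coeff (Finsupp.sumFinsuppEquivProdFinsupp m).1 f *
        MvPowerSeries.coeff (Finsupp.sumFinsuppEquivProdFinsupp m).2 g := rfl

section Tensor

variable {R : Type} [CommRing R] (f f' g g' : MvPowerSeries Times R)

theorem pderiv_tensor_inl (s : Times) :
    MvPowerSeries.pderiv R (Sum.inl s) (tensor f g) = tensor (MvPowerSeries.pderiv R s f) g := by
  ext m
  rw [MvPowerSeries.coeff_pderiv, coeff_tensor, coeff_tensor, sumEquiv_add_inl,
    MvPowerSeries.coeff_pderiv]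
  simp
  ring

theorem pderiv_tensor_inr (s : Times) :
    MvPowerSeries.pderiv R (Sum.inr s) (tensor f g) = tensor f (MvPowerSeries.pderiv R s g) := by
  ext m
  rw [MvPowerSeries.coeff_pderiv, coeff_tensor, coeff_tensor, sumEquiv_add_inr,
    MvPowerSeries.coeff_pderiv]
  simp
  ring

theorem constantCoeff_tensor : MvPowerSeries.constantCoeff (tensor f g) =
    MvPowerSeries.constantCoeff f * MvPowerSeries.constantCoeff g := by
  rw [← MvPowerSeries.coeff_zero_eq_constantCoeff_apply, coeff_tensor]
  simp [Finsupp.sumFinsuppEquivProdFinsupp]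

theorem tensor_add_left : tensor (f + f') g = tensor f g + tensor f' g := by
  ext m
  simp only [map_add, coeff_tensor, add_mul]

theorem tensor_add_right : tensor f (g + g') = tensor f g + tensor f g' := by
  ext m
  simp only [map_add, coeff_tensor, mul_add]

theorem tensor_smul_left (c : R) : tensor (c • f) g = c • tensor f g := by
  ext m
  simp only [map_smul, coeff_tensor, smul_eq_mul, mul_assoc]

theorem tensor_smul_right (c : R) : tensor f (c • g) = c • tensor f g := by
  ext m
  simp only [map_smul, coeff_tensor, smul_eq_mul]
  ring

end Tensor

/-- Turns a contour integral of a product into a sum over all integers, the shape of the sums in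
`BasicBilinear`. -/
theorem coeff_zero_mul (x y : LaurentSeries ℂ) :
    (x * y).coeff 0 = ∑ᶠ n : ℤ, x.coeff n * y.coeff (-n) := by
  rw [HahnSeries.coeff_mul]
  have hinj : Set.InjOn (Prod.fst : ℤ × ℤ → ℤ)
      (Finset.antidiagonal x.isPWO_support y.isPWO_support 0) := by
    rintro ⟨a, b⟩ h ⟨c, d⟩ h' e
    simp only [Finset.mem_coe, Finset.mem_antidiagonal] at h h' e
    ext
    · exact e
    · simp only; omega
  rw [finsum_eq_sum_of_support_subset (s := (Finset.antidiagonal x.isPWO_support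
    y.isPWO_support 0).image Prod.fst), Finset.sum_image hinj]
  · refine Finset.sum_congr rfl fun p hp => ?_
    rw [Finset.mem_antidiagonal] at hp
    congr 2
    omega
  · intro n hn
    have h1 : x.coeff n ≠ 0 := left_ne_zero_of_mul hn
    have h2 : y.coeff (-n) ≠ 0 := right_ne_zero_of_mul hn
    rw [Finset.coe_image]
    exact ⟨(n, -n), by simp [h1, h2], rfl⟩

theorem ofPowerSeries_coeff_of_neg (f : PowerSeries ℂ) {n : ℤ} (hn : n < 0) :
    (HahnSeries.ofPowerSeries ℤ ℂ f).coeff n = 0 := by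
  rw [HahnSeries.ofPowerSeries_apply]
  refine HahnSeries.embDomain_of_notMem_range ?_
  rintro ⟨a, ha⟩
  simp at ha
  omega

/-! ### The vertex operator formula -/

/-- Modes `K i n`, with generating series `∑_n K i n w^{-n}`, that satisfy the same differential
equations as `exp(-∑_s σ_s t_s w^{-|s|}) T i (t + σ [w])`, where `σ = (cp, cm)`. -/
structure VertexModes (ι : Type) (cp cm : ℂ) where
  act : Times → ι → ι
  T : ι → MvPowerSeries Times ℂ
  K : ι → ℤ → MvPowerSeries Times ℂ
  pderiv_T : ∀ s i, MvPowerSeries.pderiv ℂ s (T i) = T (act s i)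
  pderiv_K : ∀ s i n, MvPowerSeries.pderiv ℂ s (K i n) =
    (-sgn cp cm s) • K i (n - level s) + K (act s i) n
  bdd : ∀ i, ModesBdd (K i)
  constantCoeff_pos : ∀ i, ∀ n > 0, MvPowerSeries.constantCoeff (K i n) = 0
  constantCoeff_zero : ∀ i,
    MvPowerSeries.constantCoeff (K i 0) = MvPowerSeries.constantCoeff (T i)
  constantCoeff_neg : ∀ i (n : ℕ), (n : ℂ) * MvPowerSeries.constantCoeff (K i (-(n : ℤ))) =
    2 * ∑ k ∈ oddsUpTo n,
      (cp * MvPowerSeries.constantCoeff (K (act (Sum.inl k) i) (-((n - k : ℕ) : ℤ))) +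
        cm * MvPowerSeries.constantCoeff (K (act (Sum.inr k) i) (-((n - k : ℕ) : ℤ))))

theorem sgn_neg (cp cm : ℂ) (s : Times) : sgn (-cp) (-cm) s = -sgn cp cm s := by
  rcases s with k | k <;> rfl

namespace VertexModes

variable {ι : Type} {cp cm : ℂ} (M : VertexModes ι cp cm)

/-- The modes `(-1)^n K i n`. -/
def neg : VertexModes ι (-cp) (-cm) where
  act := M.act
  T := M.T
  -- The sign implements `w ↦ -w`. Since `[w]` contains only odd powers, this reverses the shift, as
  -- the factor in the primed times requires.
  K i n := ((-1 : ℂ) ^ n) • M.K i n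
  pderiv_T := M.pderiv_T
  pderiv_K s i n := by
    have h : (-1 : ℂ) ^ (n - (level s : ℤ)) = -(-1) ^ n :=
      FermionRep.neg_one_zpow_sub_odd n ⟨level s, level_odd s⟩
    rw [Derivation.map_smul, M.pderiv_K, h, sgn_neg]
    module
  bdd i m := by
    obtain ⟨N, hN⟩ := M.bdd i m
    exact ⟨N, fun n hn => by rw [map_smul, hN n hn, smul_zero]⟩
  constantCoeff_pos i n hn := by
    rw [MvPowerSeries.constantCoeff_smul, M.constantCoeff_pos i n hn, smul_zero]
  constantCoeff_zero i := by
    rw [MvPowerSeries.constantCoeff_smul, M.constantCoeff_zero, zpow_zero, one_smul]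
  constantCoeff_neg i n := by
    simp only [MvPowerSeries.constantCoeff_smul, smul_eq_mul]
    rw [mul_left_comm, M.constantCoeff_neg, mul_left_comm, Finset.mul_sum]
    congr 1
    refine Finset.sum_congr rfl fun k hk => ?_
    rw [mem_oddsUpTo] at hk
    have h : (-1 : ℂ) ^ (-((n - (k : ℕ) : ℕ) : ℤ)) = -(-1) ^ (-(n : ℤ)) := by
      rw [← FermionRep.neg_one_zpow_add_odd _ k]
      congr 1
      omega
    rw [h]
    ring

/-- Both sides obey the same recursion in `n` with the same initial value, for all `i`
simultaneously, because the derivatives of `T i` are again members of the family. -/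
theorem constantCoeff_K (e : Times → Times2) (he : Function.Injective e) (n : ℕ) :
    ∀ i, MvPowerSeries.constantCoeff (M.K i (-(n : ℤ))) = shiftCoeff e cp cm n (M.T i) := by
  induction n using Nat.strong_induction_on with
  | _ n ih =>
    intro i
    rcases Nat.eq_zero_or_pos n with rfl | hn
    · rw [shiftCoeff_zero e he, Nat.cast_zero, neg_zero, M.constantCoeff_zero]
    · have hn' : (n : ℂ) ≠ 0 := by exact_mod_cast hn.ne'
      refine mul_left_cancel₀ hn' ?_
      rw [shiftCoeff_succ e he, M.constantCoeff_neg]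
      congr 1
      refine Finset.sum_congr rfl fun k hk => ?_
      have := k.2.pos
      rw [mem_oddsUpTo] at hk
      rw [ih (n - k) (by omega), ih (n - k) (by omega), M.pderiv_T, M.pderiv_T]

theorem constantCoeff_modeSeries (e : Times → Times2) (he : Function.Injective e) (i : ι) :
    MvPowerSeries.constantCoeff (modeSeries (M.K i)) =
      MvPowerSeries.constantCoeff (shift e cp cm (M.T i)) := by
  rw [constantCoeff_shift, ← MvPowerSeries.coeff_zero_eq_constantCoeff_apply]
  ext n
  rw [coeff_modeSeries (M.bdd i), MvPowerSeries.coeff_zero_eq_constantCoeff_apply]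
  rcases lt_or_ge n 0 with hn | hn
  · rw [M.constantCoeff_pos i _ (by omega)]
    exact (ofPowerSeries_coeff_of_neg _ hn).symm
  · obtain ⟨a, rfl⟩ := Int.eq_ofNat_of_zero_le hn
    rw [M.constantCoeff_K e he, HahnSeries.ofPowerSeries_apply_coeff, PowerSeries.coeff_mk]

/-- The vertex operator formula, for the product of two copies of the modes. -/
theorem expSeries_mul_shift_mul_shift (c : Times2 → LaurentSeries ℂ)
    (hl : ∀ s, c (Sum.inl s) = (-sgn cp cm s) • wPow (-(level s : ℤ)))
    (hr : ∀ s, c (Sum.inr s) = sgn cp cm s • wPow (-(level s : ℤ))) (i j : ι) :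
    expSeries (linSeries c) * shift Sum.inl cp cm (M.T i) * shift Sum.inr (-cp) (-cm) (M.T j) =
      tensor (modeSeries (M.K i)) (modeSeries (M.neg.K j)) := by
  have hil : Function.Injective (Sum.inl : Times → Times2) := Sum.inl_injective
  have hir : Function.Injective (Sum.inr : Times → Times2) := Sum.inr_injective
  -- Uniqueness is applied to pairs: an unprimed derivative moves the first index, a primed one the
  -- second. The exponential on the left and the index shift on the right give the same scalar
  -- terms.
  refine eq_of_pderiv_eq (ι := ι × ι)
    (fun p => expSeries (linSeries c) * shift Sum.inl cp cm (M.T p.1) *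
      shift Sum.inr (-cp) (-cm) (M.T p.2))
    (fun p => tensor (modeSeries (M.K p.1)) (modeSeries (M.neg.K p.2))) c
    (Sum.elim (fun s p => (M.act s p.1, p.2)) (fun s p => (p.1, M.act s p.2))) ?_ ?_ ?_ (i, j)
  · rintro ⟨i, j⟩
    rw [constantCoeff_tensor, M.constantCoeff_modeSeries _ hil,
      M.neg.constantCoeff_modeSeries _ hir, map_mul, map_mul, constantCoeff_expSeries, one_mul]
    rfl
  · rintro (s | s) ⟨i, j⟩
    · simp only [Derivation.leibniz, pderiv_expSeries, pderiv_shift _ hil, M.pderiv_T,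
        pderiv_shift_of_notMem _ hir _ _ (Sum.inl s) (by simp), smul_eq_mul, Sum.elim_inl,
        MvPowerSeries.smul_eq_C_mul]
      ring
    · simp only [Derivation.leibniz, pderiv_expSeries, pderiv_shift _ hir, M.pderiv_T,
        pderiv_shift_of_notMem _ hil _ _ (Sum.inr s) (by simp), smul_eq_mul, Sum.elim_inr,
        MvPowerSeries.smul_eq_C_mul]
      ring
  · rintro (s | s) ⟨i, j⟩
    · rw [pderiv_tensor_inl, pderiv_modeSeries (M.bdd i) (M.bdd (M.act s i)) s _ _
        (M.pderiv_K s i), tensor_add_left, tensor_smul_left, hl]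
      rfl
    · rw [pderiv_tensor_inr, pderiv_modeSeries (M.neg.bdd j) (M.neg.bdd (M.act s j)) s _ _
        (M.neg.pderiv_K s j), tensor_add_right, tensor_smul_right, hr, sgn_neg, neg_neg]
      rfl

theorem coeff_contourIntegral (c : Times2 → LaurentSeries ℂ)
    (hl : ∀ s, c (Sum.inl s) = (-sgn cp cm s) • wPow (-(level s : ℤ)))
    (hr : ∀ s, c (Sum.inr s) = sgn cp cm s • wPow (-(level s : ℤ))) (i j : ι)
    (m : Times2 →₀ ℕ) :
    contourIntegral (expSeries (linSeries c) * shift Sum.inl cp cm (M.T i) *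
      shift Sum.inr (-cp) (-cm) (M.T j)) m =
      ∑ᶠ n : ℤ, (-1 : ℂ) ^ n *
        (MvPowerSeries.coeff (Finsupp.sumFinsuppEquivProdFinsupp m).1 (M.K i (-n)) *
          MvPowerSeries.coeff (Finsupp.sumFinsuppEquivProdFinsupp m).2 (M.K j n)) := by
  rw [contourIntegral, M.expSeries_mul_shift_mul_shift c hl hr, coeff_tensor, coeff_zero_mul]
  refine finsum_congr fun n => ?_
  rw [coeff_modeSeries (M.bdd i), coeff_modeSeries (M.neg.bdd j), neg_neg]
  change _ * MvPowerSeries.coeff _ (((-1 : ℂ) ^ n) • M.K j n) = _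
  rw [map_smul, smul_eq_mul]
  ring

end VertexModes

/-! ### The bilinear identity for tau functions -/

theorem matrixElement_coeff (G : Op) (U : FockL) (V : FockR) (m : Times →₀ ℕ) :
    MvPowerSeries.coeff m (matrixElement G U V) =
      G (braExp U (Finsupp.sumFinsuppEquivProdFinsupp m).1)
        (ketExp V (Finsupp.sumFinsuppEquivProdFinsupp m).2) := rfl

theorem braExp_zero (U : FockL) : braExp U 0 = U := leftRep.expCurrent_zero U

theorem ketExp_zero (V : FockR) : ketExp V 0 = V := rightRep.expCurrent_zero V

theorem braExp_add_single (U : FockL) (m : Odds →₀ ℕ) (k : Odds) :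
    ((m k : ℂ) + 1) • braExp U (m + Finsupp.single k 1) = hPlus k (braExp U m) :=
  leftRep.expCurrent_add_single U m k

theorem ketExp_add_single (V : FockR) (m : Odds →₀ ℕ) (k : Odds) :
    ((m k : ℂ) + 1) • ketExp V (m + Finsupp.single k 1) = hMinus k (ketExp V m) :=
  rightRep.expCurrent_add_single V m k

theorem sumEquiv_zero {α β : Type} :
    Finsupp.sumFinsuppEquivProdFinsupp (0 : α ⊕ β →₀ ℕ) = (0, 0) := by
  ext x <;> simp

/-- The series `⟨U|e^{H_+(t)} φ_n G e^{H_-(t)}|V⟩`. -/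
def leftMode (U : FockL) (V : FockR) (G : Op) (n : ℤ) : MvPowerSeries Times ℂ := fun m =>
  G (leftRep.psi n (braExp U (Finsupp.sumFinsuppEquivProdFinsupp m).1))
    (ketExp V (Finsupp.sumFinsuppEquivProdFinsupp m).2)

/-- The series `⟨U|e^{H_+(t)} G φ_{-n} e^{H_-(t)}|V⟩`. -/
def rightMode (U : FockL) (V : FockR) (G : Op) (n : ℤ) : MvPowerSeries Times ℂ := fun m =>
  G (braExp U (Finsupp.sumFinsuppEquivProdFinsupp m).1)
    (rightRep.psi n (ketExp V (Finsupp.sumFinsuppEquivProdFinsupp m).2))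

theorem coeff_leftMode (U : FockL) (V : FockR) (G : Op) (n : ℤ) (m : Times →₀ ℕ) :
    MvPowerSeries.coeff m (leftMode U V G n) =
      G (leftRep.psi n (braExp U (Finsupp.sumFinsuppEquivProdFinsupp m).1))
        (ketExp V (Finsupp.sumFinsuppEquivProdFinsupp m).2) := rfl

theorem coeff_rightMode (U : FockL) (V : FockR) (G : Op) (n : ℤ) (m : Times →₀ ℕ) :
    MvPowerSeries.coeff m (rightMode U V G n) =
      G (braExp U (Finsupp.sumFinsuppEquivProdFinsupp m).1)
        (rightRep.psi n (ketExp V (Finsupp.sumFinsuppEquivProdFinsupp m).2)) := rfl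

theorem constantCoeff_leftMode (U : FockL) (V : FockR) (G : Op) (n : ℤ) :
    MvPowerSeries.constantCoeff (leftMode U V G n) = G (leftRep.psi n U) V := by
  rw [← MvPowerSeries.coeff_zero_eq_constantCoeff_apply, coeff_leftMode, sumEquiv_zero,
    braExp_zero, ketExp_zero]

theorem constantCoeff_rightMode (U : FockL) (V : FockR) (G : Op) (n : ℤ) :
    MvPowerSeries.constantCoeff (rightMode U V G n) = G U (rightRep.psi n V) := by
  rw [← MvPowerSeries.coeff_zero_eq_constantCoeff_apply, coeff_rightMode, sumEquiv_zero,
    braExp_zero, ketExp_zero]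

theorem constantCoeff_matrixElement (U : FockL) (V : FockR) (G : Op) :
    MvPowerSeries.constantCoeff (matrixElement G U V) = G U V := by
  rw [← MvPowerSeries.coeff_zero_eq_constantCoeff_apply, matrixElement_coeff, sumEquiv_zero,
    braExp_zero, ketExp_zero]

/-- The modes of a left vacuum. -/
def leftModes (U : FockL) (hU : ∀ n > 0, leftRep.psi n U = 0) (V : FockR) :
    VertexModes Op (-1) 0 where
  act := actOp
  T G := matrixElement G (leftRep.psi 0 U) V
  K := leftMode U V
  pderiv_T s G := pderiv_matrixElement s G _ _
  pderiv_K s G n := by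
    ext m
    rw [MvPowerSeries.coeff_pderiv, map_add, map_smul, coeff_leftMode, coeff_leftMode,
      coeff_leftMode]
    rcases s with k | k
    · have h1 := congrArg (leftRep.psi n)
        (braExp_add_single U (Finsupp.sumFinsuppEquivProdFinsupp m).1 k)
      -- The derivative inserts `H_k` between `U` and `φ_n`. Moving it past `φ_n`, next to `G`,
      -- costs the mode of index `n - k`.
      have h2 := leftRep.H_psi k n (braExp U (Finsupp.sumFinsuppEquivProdFinsupp m).1)
      rw [map_smul] at h1
      change hPlus k _ = leftRep.psi n (hPlus k _) - (1 : ℂ) • _ at h2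
      rw [← h1, one_smul] at h2
      change _ = _ + G (hPlus k _) _
      rw [h2, sumEquiv_add_inl, map_sub, map_smul, LinearMap.sub_apply, LinearMap.smul_apply]
      simp [sgn, level]
      ring
    · have h1 := ketExp_add_single V (Finsupp.sumFinsuppEquivProdFinsupp m).2 k
      change _ = _ + G _ (hMinus k _)
      rw [← h1, sumEquiv_add_inr, map_smul]
      simp [sgn]
      ring
  bdd G m := by
    obtain ⟨N, _, hN⟩ := leftRep.bdd (braExp U (Finsupp.sumFinsuppEquivProdFinsupp m).1)
    exact ⟨N, fun n hn => by rw [coeff_leftMode, hN n hn, map_zero, LinearMap.zero_apply]⟩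
  constantCoeff_pos G n hn := by
    rw [constantCoeff_leftMode, hU n hn, map_zero, LinearMap.zero_apply]
  constantCoeff_zero G := by
    rw [constantCoeff_leftMode, constantCoeff_matrixElement]
  constantCoeff_neg G n := by
    have h := congrArg (fun x => G x V) (leftRep.vacuum_recursion hU n)
    simp only [map_smul, map_sum, LinearMap.smul_apply, LinearMap.sum_apply, smul_eq_mul] at h
    simp only [constantCoeff_leftMode, zero_mul, add_zero, ← Finset.mul_sum]
    rw [h]
    change -2 * 1 * _ = 2 * (-1 * ∑ k ∈ oddsUpTo n, G (hPlus k _) V)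
    rw [mul_one, neg_one_mul, mul_neg, neg_mul]
    rfl

/-- The modes of a right vacuum. -/
def rightModes (U : FockL) (V : FockR) (hV : ∀ n > 0, rightRep.psi n V = 0) :
    VertexModes Op 0 1 where
  act := actOp
  T G := matrixElement G U (rightRep.psi 0 V)
  K := rightMode U V
  pderiv_T s G := pderiv_matrixElement s G _ _
  pderiv_K s G n := by
    ext m
    rw [MvPowerSeries.coeff_pderiv, map_add, map_smul, coeff_rightMode, coeff_rightMode,
      coeff_rightMode]
    rcases s with k | k
    · have h1 := braExp_add_single U (Finsupp.sumFinsuppEquivProdFinsupp m).1 k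
      change _ = _ + G (hPlus k _) _
      rw [← h1, sumEquiv_add_inl, map_smul, LinearMap.smul_apply]
      simp [sgn]
      ring
    · have h1 := congrArg (rightRep.psi n)
        (ketExp_add_single V (Finsupp.sumFinsuppEquivProdFinsupp m).2 k)
      have h2 := rightRep.H_psi k n (ketExp V (Finsupp.sumFinsuppEquivProdFinsupp m).2)
      rw [map_smul] at h1
      change hMinus k _ = rightRep.psi n (hMinus k _) - (-1 : ℂ) • _ at h2
      rw [← h1, neg_one_smul, sub_neg_eq_add] at h2
      change _ = _ + G _ (hMinus k _)
      rw [h2, sumEquiv_add_inr, map_add, map_smul]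
      simp [sgn, level]
      ring
  bdd G m := by
    obtain ⟨N, _, hN⟩ := rightRep.bdd (ketExp V (Finsupp.sumFinsuppEquivProdFinsupp m).2)
    exact ⟨N, fun n hn => by rw [coeff_rightMode, hN n hn, map_zero]⟩
  constantCoeff_pos G n hn := by
    rw [constantCoeff_rightMode, hV n hn, map_zero]
  constantCoeff_zero G := by
    rw [constantCoeff_rightMode, constantCoeff_matrixElement]
  constantCoeff_neg G n := by
    have h := congrArg (fun x => G U x) (rightRep.vacuum_recursion hV n)
    simp only [map_smul, map_sum, smul_eq_mul] at h
    simp only [constantCoeff_rightMode, zero_mul, zero_add, one_mul]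
    rw [h]
    change -2 * -1 * _ = 2 * ∑ k ∈ oddsUpTo n, G U (hMinus k _)
    norm_num
    rfl

theorem contourIntegral_xiPlus (M : VertexModes Op (-1) 0) (G : Op) (m : Times2 →₀ ℕ) :
    contourIntegral (expSeries xiPlus * shift Sum.inl (-1) 0 (M.T G) *
      shift Sum.inr 1 0 (M.T G)) m =
      ∑ᶠ n : ℤ, (-1 : ℂ) ^ n *
        (MvPowerSeries.coeff (Finsupp.sumFinsuppEquivProdFinsupp m).1 (M.K G (-n)) *
          MvPowerSeries.coeff (Finsupp.sumFinsuppEquivProdFinsupp m).2 (M.K G n)) := by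
  rw [xiPlus, ← M.coeff_contourIntegral _ _ _ G G m, neg_neg, neg_zero]
  · rintro (k | k) <;> rw [smul_wPow] <;> simp [sgn, level, wPow]
  · rintro (k | k) <;> rw [smul_wPow] <;> simp [sgn, level, wPow]

theorem contourIntegral_xiMinus (M : VertexModes Op 0 1) (G : Op) (m : Times2 →₀ ℕ) :
    contourIntegral (expSeries xiMinus * shift Sum.inl 0 1 (M.T G) *
      shift Sum.inr 0 (-1) (M.T G)) m =
      ∑ᶠ n : ℤ, (-1 : ℂ) ^ n *
        (MvPowerSeries.coeff (Finsupp.sumFinsuppEquivProdFinsupp m).1 (M.K G (-n)) *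
          MvPowerSeries.coeff (Finsupp.sumFinsuppEquivProdFinsupp m).2 (M.K G n)) := by
  rw [xiMinus, ← M.coeff_contourIntegral _ _ _ G G m, neg_zero]
  · rintro (k | k) <;> rw [smul_wPow] <;> simp [sgn, level, wPow]
  · rintro (k | k) <;> rw [smul_wPow] <;> simp [sgn, level, wPow]

/-- The condition is quadratic in `G`; this allows replacing `G` by `2 G` to absorb `φ_0² = 1/2`. -/
theorem BasicBilinear.smul {G : Op} (hb : BasicBilinear G) (c : ℂ) : BasicBilinear (c • G) := by
  intro U U' V V'
  have h := congrArg (fun x => (c * c) • x) (hb U U' V V')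
  simp only [smul_finsum] at h
  refine (finsum_congr fun n => ?_).trans (h.trans (finsum_congr fun n => ?_)) <;>
    simp only [LinearMap.smul_apply, smul_eq_mul] <;> ring

theorem vacuum_left (n : ℤ) (hn : n > 0) : leftRep.psi n (braOf (phi 0)) = 0 := by
  refine (Submodule.Quotient.mk_eq_zero _).2 ?_
  rw [LinearMap.mulRight_apply, phi_zero_mul_phi n hn.ne']
  exact cre.neg_mem (Submodule.subset_span ⟨_, n, hn, rfl⟩)

theorem vacuum_right (n : ℤ) (hn : n > 0) : rightRep.psi n (ketOf 1) = 0 := by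
  refine (Submodule.Quotient.mk_eq_zero _).2 ?_
  rw [LinearMap.mulLeft_apply, mul_one]
  exact Submodule.subset_span ⟨1, -n, by omega, (one_mul _).symm⟩

theorem tau_eq {G : Op} (hG : IsFermionic G) :
    tau G = (2 : ℂ) • matrixElement G (braOf (phi 0)) (ketOf (phi 0)) := by
  have h := matrixElement_zero hG (braOf 1) (ketOf 1)
  have h1 : zeroL (braOf 1) = braOf (phi 0) := congrArg braOf (mul_one (phi 0))
  have h2 : zeroR (ketOf 1) = ketOf (phi 0) := congrArg ketOf (one_mul (phi 0))
  rw [h1, h2] at h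
  rw [h, smul_smul, tau]
  norm_num

theorem matrixElement_smul (c : ℂ) (G : Op) (U : FockL) (V : FockR) :
    matrixElement (c • G) U V = c • matrixElement G U V := rfl

theorem matrixElement_smul_left (c : ℂ) (G : Op) (U : FockL) (V : FockR) :
    matrixElement G (c • U) V = c • matrixElement G U V := by
  funext m
  have h := leftRep.map_expCurrent (c • LinearMap.id) (fun n v => by simp) U
    (Finsupp.sumFinsuppEquivProdFinsupp m).1
  change c • braExp U _ = braExp (c • U) _ at h
  change G (braExp (c • U) _) _ = c • G (braExp U _) _
  rw [← h, map_smul, LinearMap.smul_apply]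

/-- The bra carries `φ_0` and the ket does not. Then the zero mode of `φ_n G` collapses to `φ_0²`,
while that of `G φ_{-n}` puts a `φ_0` at both ends; both equal `τ` after scaling `G` by 2. -/
theorem negativeBKP_tau {G : Op} (hG : IsFermionic G) (hb : BasicBilinear G) :
    NegativeBKP (tau G) := by
  have hL : (leftModes (braOf (phi 0)) vacuum_left (ketOf 1)).T ((2 : ℂ) • G) = tau G := by
    change matrixElement _ (braOf (phi 0 * phi 0)) _ = _
    rw [phi_zero_mul_phi_zero, ← mul_one (algebraMap ℂ Cl (1 / 2)), ← Algebra.smul_def, map_smul,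
      matrixElement_smul_left, matrixElement_smul, smul_smul, tau]
    norm_num
  have hR : (rightModes (braOf (phi 0)) (ketOf 1) vacuum_right).T ((2 : ℂ) • G) = tau G := by
    change matrixElement _ _ (ketOf (phi (-0) * 1)) = _
    rw [neg_zero, mul_one, matrixElement_smul, tau_eq hG]
  have h1 := contourIntegral_xiPlus (leftModes (braOf (phi 0)) vacuum_left (ketOf 1))
    ((2 : ℂ) • G)
  have h2 := contourIntegral_xiMinus (rightModes (braOf (phi 0)) (ketOf 1) vacuum_right)
    ((2 : ℂ) • G)
  rw [hL] at h1
  rw [hR] at h2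
  funext m
  -- Only the side of the bra needs `n ↦ -n`: the mode indices on `F_B` are already reversed in
  -- `rightRep`.
  rw [h1, h2, ← finsum_comp_equiv (Equiv.neg ℤ)]
  simp only [Equiv.neg_apply, neg_neg, negOne_zpow_neg]
  have h := hb.smul 2 (braExp (braOf (phi 0)) (Finsupp.sumFinsuppEquivProdFinsupp
      (Finsupp.sumFinsuppEquivProdFinsupp m).1).1)
    (braExp (braOf (phi 0)) (Finsupp.sumFinsuppEquivProdFinsupp
      (Finsupp.sumFinsuppEquivProdFinsupp m).2).1)
    (ketExp (ketOf 1) (Finsupp.sumFinsuppEquivProdFinsupp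
      (Finsupp.sumFinsuppEquivProdFinsupp m).1).2)
    (ketExp (ketOf 1) (Finsupp.sumFinsuppEquivProdFinsupp
      (Finsupp.sumFinsuppEquivProdFinsupp m).2).2)
  refine h.symm.trans (finsum_congr fun n => ?_)
  have hn : phi n = phi (- -n) := by rw [neg_neg]
  rw [hn]
  rfl

/-! ### The first member of the hierarchy -/

section Diagonal

variable {R : Type} [CommRing R]

theorem diag_hasSubst : MvPowerSeries.HasSubst
    fun u : Times2 => (MvPowerSeries.X (Sum.elim id id u) : MvPowerSeries Times R) where
  const_coeff u := by simp
  coeff_zero d := by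
    classical
    have h : {s : Times | d = Finsupp.single s 1}.Finite :=
      Set.Subsingleton.finite fun s hs s' hs' => by
        have h := (hs.symm.trans hs' : Finsupp.single _ 1 = Finsupp.single _ 1)
        exact Finsupp.single_left_injective one_ne_zero h
    refine ((h.image Sum.inl).union (h.image Sum.inr)).subset ?_
    intro u hu
    have hd : d = Finsupp.single (Sum.elim id id u) 1 := by
      by_contra hc
      exact hu (by rw [MvPowerSeries.coeff_X, if_neg hc])
    rcases u with s | s
    · exact Or.inl ⟨s, hd, rfl⟩
    · exact Or.inr ⟨s, hd, rfl⟩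

/-- The restriction of a series to equal primed and unprimed times. -/
def diag : MvPowerSeries Times2 R →ₐ[R] MvPowerSeries Times R :=
  MvPowerSeries.substAlgHom diag_hasSubst

theorem pderiv_diag (s : Times) (f : MvPowerSeries Times2 R) :
    MvPowerSeries.pderiv R s (diag f) =
      diag (MvPowerSeries.pderiv R (Sum.inl s) f + MvPowerSeries.pderiv R (Sum.inr s) f) := by
  rw [diag, MvPowerSeries.substAlgHom_apply, MvPowerSeries.substAlgHom_apply,
    pderiv_subst diag_hasSubst s {Sum.inl s, Sum.inr s}, Finset.sum_pair (by simp),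
    MvPowerSeries.subst_add diag_hasSubst]
  · simp
  · rintro (u | u) hu <;>
    · refine MvPowerSeries.pderiv_X_of_ne fun h => hu ?_
      simp at h
      simp [h]

theorem constantCoeff_diag (f : MvPowerSeries Times2 R) :
    MvPowerSeries.constantCoeff (diag f) = MvPowerSeries.constantCoeff f := by
  rw [diag, MvPowerSeries.substAlgHom_apply,
    constantCoeff_subst_of_constantCoeff_eq_zero diag_hasSubst (fun u => by simp)]
  rfl

end Diagonal

/-! ### Coefficients in `w` on the diagonal -/

/-- The coefficient of `w^n`. -/
def wCoeff {σ : Type} (n : ℤ) : MvPowerSeries σ (LaurentSeries ℂ) →+ MvPowerSeries σ ℂ where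
  toFun F m := (MvPowerSeries.coeff m F).coeff n
  map_zero' := rfl
  map_add' _ _ := rfl

theorem coeff_wCoeff {σ : Type} (n : ℤ) (F : MvPowerSeries σ (LaurentSeries ℂ)) (m : σ →₀ ℕ) :
    MvPowerSeries.coeff m (wCoeff n F) = (MvPowerSeries.coeff m F).coeff n := rfl

theorem constantCoeff_wCoeff {σ : Type} (n : ℤ) (F : MvPowerSeries σ (LaurentSeries ℂ)) :
    MvPowerSeries.constantCoeff (wCoeff n F) = (MvPowerSeries.constantCoeff F).coeff n := rfl

theorem pderiv_wCoeff {σ : Type} (n : ℤ) (F : MvPowerSeries σ (LaurentSeries ℂ)) (s : σ) :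
    MvPowerSeries.pderiv ℂ s (wCoeff n F) =
      wCoeff n (MvPowerSeries.pderiv (LaurentSeries ℂ) s F) := by
  ext m
  rw [MvPowerSeries.coeff_pderiv, coeff_wCoeff, coeff_wCoeff, MvPowerSeries.coeff_pderiv,
    natCast_add_one_coeff]

theorem wCoeff_C_wPow_mul {σ : Type} (n l : ℤ) (F : MvPowerSeries σ (LaurentSeries ℂ)) :
    wCoeff n (MvPowerSeries.C (wPow l) * F) = wCoeff (n - l) F := by
  ext m
  have h := coeff_smul_wPow_mul 1 l (MvPowerSeries.coeff m F) n
  rw [smul_wPow, one_mul] at h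
  rw [coeff_wCoeff, coeff_wCoeff, MvPowerSeries.coeff_C_mul, wPow, h]

/-- The two substitutions live over different coefficient rings. Uniqueness settles the comparison,
with the family indexed by all series and `∂_s + ∂'_s` acting on the index. -/
theorem diag_wCoeff (n : ℤ) (F : MvPowerSeries Times2 (LaurentSeries ℂ)) :
    diag (wCoeff n F) = wCoeff n (diag F) := by
  refine eq_of_pderiv_eq (fun F => diag (wCoeff n F)) (fun F => wCoeff n (diag F)) 0
    (fun s F => MvPowerSeries.pderiv _ (Sum.inl s) F + MvPowerSeries.pderiv _ (Sum.inr s) F)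
    ?_ ?_ ?_ F
  · intro F
    rw [constantCoeff_diag, constantCoeff_wCoeff, constantCoeff_wCoeff, constantCoeff_diag]
  · intro s F
    simp only [pderiv_diag, pderiv_wCoeff, map_add, Pi.zero_apply, zero_smul, zero_add]
  · intro s F
    simp only [pderiv_diag, pderiv_wCoeff, Pi.zero_apply, zero_smul, zero_add]

/-- The exponent is antisymmetric in the two sets of times, so every derivative along the diagonal
vanishes. -/
theorem diag_expSeries (c : Times2 → LaurentSeries ℂ)
    (hc : ∀ s, c (Sum.inl s) + c (Sum.inr s) = 0) : diag (expSeries (linSeries c)) = 1 := by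
  refine MvPowerSeries.pderiv.ext (fun s => ?_) ?_
  · rw [pderiv_diag, pderiv_expSeries, pderiv_expSeries, ← add_smul, hc, MvPowerSeries.smul_eq_C_mul,
      map_zero, zero_mul, map_zero, MvPowerSeries.pderiv_one]
  · rw [constantCoeff_diag, constantCoeff_expSeries, map_one]

/-- The coefficient of `w^n` in `f(t_+ + cp [w], t_- + cm [w])`. -/
def shiftTerm (e : Times → Times2) (cp cm : ℂ) (n : ℕ) (f : MvPowerSeries Times ℂ) :
    MvPowerSeries Times ℂ := wCoeff n (diag (shift e cp cm f))

theorem pderiv_diag_shift {e : Times → Times2} (he : e = Sum.inl ∨ e = Sum.inr) (cp cm : ℂ)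
    (s : Times) (f : MvPowerSeries Times ℂ) :
    MvPowerSeries.pderiv (LaurentSeries ℂ) s (diag (shift e cp cm f)) =
      diag (shift e cp cm (MvPowerSeries.pderiv ℂ s f)) := by
  rw [pderiv_diag]
  rcases he with rfl | rfl
  · rw [pderiv_shift _ Sum.inl_injective,
      pderiv_shift_of_notMem _ Sum.inl_injective _ _ (Sum.inr s) (by simp), add_zero]
  · rw [pderiv_shift _ Sum.inr_injective,
      pderiv_shift_of_notMem _ Sum.inr_injective _ _ (Sum.inl s) (by simp), zero_add]

theorem pderiv_shiftTerm {e : Times → Times2} (he : e = Sum.inl ∨ e = Sum.inr) (cp cm : ℂ)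
    (n : ℕ) (s : Times) (f : MvPowerSeries Times ℂ) :
    MvPowerSeries.pderiv ℂ s (shiftTerm e cp cm n f) =
      shiftTerm e cp cm n (MvPowerSeries.pderiv ℂ s f) := by
  rw [shiftTerm, pderiv_wCoeff, pderiv_diag_shift he, shiftTerm]

theorem constantCoeff_shiftTerm (e : Times → Times2) (cp cm : ℂ) (n : ℕ)
    (f : MvPowerSeries Times ℂ) :
    MvPowerSeries.constantCoeff (shiftTerm e cp cm n f) = shiftCoeff e cp cm n f := by
  rw [shiftTerm, constantCoeff_wCoeff, constantCoeff_diag, constantCoeff_shift,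
    HahnSeries.ofPowerSeries_apply_coeff, PowerSeries.coeff_mk]

theorem injective_of_eq {e : Times → Times2} (he : e = Sum.inl ∨ e = Sum.inr) :
    Function.Injective e := by
  rcases he with rfl | rfl
  · exact Sum.inl_injective
  · exact Sum.inr_injective

theorem shiftTerm_zero {e : Times → Times2} (he : e = Sum.inl ∨ e = Sum.inr) (cp cm : ℂ)
    (f : MvPowerSeries Times ℂ) : shiftTerm e cp cm 0 f = f := by
  refine eq_of_pderiv_eq (shiftTerm e cp cm 0) id 0 (fun s => MvPowerSeries.pderiv ℂ s)
    ?_ ?_ ?_ f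
  · intro f
    rw [constantCoeff_shiftTerm, shiftCoeff_zero e (injective_of_eq he), id]
  · intro s f
    rw [pderiv_shiftTerm he, Pi.zero_apply, zero_smul, zero_add]
  · intro s f
    rw [Pi.zero_apply, zero_smul, zero_add]
    rfl

/-- The recursion of `shiftCoeff_succ` at time zero extends to all times by uniqueness, since
translation commutes with derivatives. -/
theorem shiftTerm_succ {e : Times → Times2} (he : e = Sum.inl ∨ e = Sum.inr) (cp cm : ℂ) (n : ℕ)
    (f : MvPowerSeries Times ℂ) :
    (n : MvPowerSeries Times ℂ) * shiftTerm e cp cm n f =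
      2 * ∑ k ∈ oddsUpTo n,
        (MvPowerSeries.C cp * shiftTerm e cp cm (n - k) (MvPowerSeries.pderiv ℂ (Sum.inl k) f) +
          MvPowerSeries.C cm *
            shiftTerm e cp cm (n - k) (MvPowerSeries.pderiv ℂ (Sum.inr k) f)) := by
  refine eq_of_pderiv_eq (fun f => (n : MvPowerSeries Times ℂ) * shiftTerm e cp cm n f)
    (fun f => 2 * ∑ k ∈ oddsUpTo n,
        (MvPowerSeries.C cp * shiftTerm e cp cm (n - k) (MvPowerSeries.pderiv ℂ (Sum.inl k) f) +
          MvPowerSeries.C cm *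
            shiftTerm e cp cm (n - k) (MvPowerSeries.pderiv ℂ (Sum.inr k) f)))
    0 (fun s => MvPowerSeries.pderiv ℂ s) ?_ ?_ ?_ f
  · intro f
    have h := shiftCoeff_succ e (injective_of_eq he) cp cm n f
    simp only [← constantCoeff_shiftTerm] at h
    simp only [map_mul, map_natCast, map_sum, map_add, MvPowerSeries.constantCoeff_C, map_ofNat, h]
  · intro s f
    rw [Pi.zero_apply, zero_smul, zero_add, Derivation.leibniz, Derivation.map_natCast,
      pderiv_shiftTerm he, smul_zero, add_zero, smul_eq_mul]
  · intro s f
    have h2 : MvPowerSeries.pderiv ℂ s (2 : MvPowerSeries Times ℂ) = 0 :=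
      Derivation.map_natCast _ 2
    rw [Pi.zero_apply, zero_smul, zero_add, Derivation.leibniz, h2, smul_zero, add_zero,
      smul_eq_mul, map_sum]
    congr 1
    refine Finset.sum_congr rfl fun k _ => ?_
    simp only [map_add, Derivation.leibniz, MvPowerSeries.pderiv_C, smul_eq_mul, mul_zero,
      add_zero, pderiv_shiftTerm he, pderiv_comm s]

theorem wCoeff_diag_shift_of_neg {e : Times → Times2} (he : e = Sum.inl ∨ e = Sum.inr) (cp cm : ℂ)
    {n : ℤ} (hn : n < 0) (f : MvPowerSeries Times ℂ) :
    wCoeff n (diag (shift e cp cm f)) = 0 := by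
  refine eq_of_pderiv_eq (fun f => wCoeff n (diag (shift e cp cm f))) (fun _ => 0) 0
    (fun s => MvPowerSeries.pderiv ℂ s) ?_ ?_ ?_ f
  · intro f
    rw [constantCoeff_wCoeff, constantCoeff_diag, constantCoeff_shift,
      ofPowerSeries_coeff_of_neg _ hn, map_zero]
  · intro s f
    rw [Pi.zero_apply, zero_smul, zero_add, pderiv_wCoeff, pderiv_diag_shift he]
  · intro s f
    simp

theorem coeff_diag_shift {e : Times → Times2} (he : e = Sum.inl ∨ e = Sum.inr) (cp cm : ℂ)
    (f : MvPowerSeries Times ℂ) (m : Times →₀ ℕ) :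
    MvPowerSeries.coeff m (diag (shift e cp cm f)) = HahnSeries.ofPowerSeries ℤ ℂ
      (PowerSeries.mk fun n => MvPowerSeries.coeff m (shiftTerm e cp cm n f)) := by
  ext n
  rcases lt_or_ge n 0 with hn | hn
  · rw [ofPowerSeries_coeff_of_neg _ hn, ← coeff_wCoeff, wCoeff_diag_shift_of_neg he _ _ hn,
      map_zero]
  · obtain ⟨a, rfl⟩ := Int.eq_ofNat_of_zero_le hn
    rw [HahnSeries.ofPowerSeries_apply_coeff, PowerSeries.coeff_mk]
    rfl

/-- The shifted series have no negative powers of `w`, so the coefficient of a product is a finite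
Cauchy sum. -/
theorem wCoeff_diag_shift_mul {e e' : Times → Times2} (he : e = Sum.inl ∨ e = Sum.inr)
    (he' : e' = Sum.inl ∨ e' = Sum.inr) (cp cm cp' cm' : ℂ) (f g : MvPowerSeries Times ℂ) (n : ℕ) :
    wCoeff n (diag (shift e cp cm f) * diag (shift e' cp' cm' g)) =
      ∑ p ∈ Finset.HasAntidiagonal.antidiagonal n,
        shiftTerm e cp cm p.1 f * shiftTerm e' cp' cm' p.2 g := by
  classical
  ext m
  simp only [coeff_wCoeff, map_sum, MvPowerSeries.coeff_mul, coeff_diag_shift he,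
    coeff_diag_shift he']
  rw [Finset.sum_comm]
  simp only [← map_mul, ← map_sum]
  rw [HahnSeries.ofPowerSeries_apply_coeff, map_sum]
  simp only [PowerSeries.coeff_mul, PowerSeries.coeff_mk]

/-! ### Hirota derivatives of the integrands -/

/-- The integrand of the bilinear identity. -/
def integrand (c : Times2 → LaurentSeries ℂ) (cp cm : ℂ) (f g : MvPowerSeries Times ℂ) :
    MvPowerSeries Times2 (LaurentSeries ℂ) :=
  expSeries (linSeries c) * shift Sum.inl cp cm f * shift Sum.inr (-cp) (-cm) g

/-- The derivation `∂_s - ∂'_s`. -/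
def diffD {R : Type} [CommRing R] (s : Times) :
    Derivation R (MvPowerSeries Times2 R) (MvPowerSeries Times2 R) :=
  MvPowerSeries.pderiv R (Sum.inl s) - MvPowerSeries.pderiv R (Sum.inr s)

theorem diffD_wCoeff (n : ℤ) (F : MvPowerSeries Times2 (LaurentSeries ℂ)) (s : Times) :
    diffD s (wCoeff n F) = wCoeff n (diffD s F) := by
  simp only [diffD, Derivation.sub_apply, pderiv_wCoeff, map_sub]

theorem diffD_integrand (c : Times2 → LaurentSeries ℂ) (cp cm : ℂ)
    (f g : MvPowerSeries Times ℂ) (s : Times) :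
    diffD s (integrand c cp cm f g) =
      MvPowerSeries.C (c (Sum.inl s) - c (Sum.inr s)) * integrand c cp cm f g +
        integrand c cp cm (MvPowerSeries.pderiv ℂ s f) g -
          integrand c cp cm f (MvPowerSeries.pderiv ℂ s g) := by
  have hil : Function.Injective (Sum.inl : Times → Times2) := Sum.inl_injective
  have hir : Function.Injective (Sum.inr : Times → Times2) := Sum.inr_injective
  simp only [diffD, integrand, Derivation.sub_apply, Derivation.leibniz, pderiv_expSeries,
    pderiv_shift _ hil, pderiv_shift _ hir,
    pderiv_shift_of_notMem _ hir _ _ (Sum.inl s) (by simp),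
    pderiv_shift_of_notMem _ hil _ _ (Sum.inr s) (by simp), smul_eq_mul,
    MvPowerSeries.smul_eq_C_mul, map_sub]
  ring

theorem diffD_diffD_integrand (c : Times2 → LaurentSeries ℂ) (cp cm : ℂ)
    (f : MvPowerSeries Times ℂ) (s u : Times) :
    diffD u (diffD s (integrand c cp cm f f)) =
      MvPowerSeries.C ((c (Sum.inl s) - c (Sum.inr s)) * (c (Sum.inl u) - c (Sum.inr u))) *
        integrand c cp cm f f +
      MvPowerSeries.C (c (Sum.inl s) - c (Sum.inr s)) *
        (integrand c cp cm (MvPowerSeries.pderiv ℂ u f) f -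
          integrand c cp cm f (MvPowerSeries.pderiv ℂ u f)) +
      MvPowerSeries.C (c (Sum.inl u) - c (Sum.inr u)) *
        (integrand c cp cm (MvPowerSeries.pderiv ℂ s f) f -
          integrand c cp cm f (MvPowerSeries.pderiv ℂ s f)) +
      (integrand c cp cm (MvPowerSeries.pderiv ℂ u (MvPowerSeries.pderiv ℂ s f)) f -
        integrand c cp cm (MvPowerSeries.pderiv ℂ s f) (MvPowerSeries.pderiv ℂ u f) -
        integrand c cp cm (MvPowerSeries.pderiv ℂ u f) (MvPowerSeries.pderiv ℂ s f) +
        integrand c cp cm f (MvPowerSeries.pderiv ℂ u (MvPowerSeries.pderiv ℂ s f))) := by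
  have hC (a : LaurentSeries ℂ) :
      diffD u (MvPowerSeries.C a : MvPowerSeries Times2 (LaurentSeries ℂ)) = 0 := by
    simp [diffD]
  simp only [diffD_integrand, map_add, map_sub, Derivation.leibniz, hC, smul_eq_mul, map_mul]
  ring

theorem wCoeff_diag_integrand (c : Times2 → LaurentSeries ℂ)
    (hc : ∀ s, c (Sum.inl s) + c (Sum.inr s) = 0) (cp cm : ℂ) (f g : MvPowerSeries Times ℂ)
    (n : ℕ) :
    wCoeff n (diag (integrand c cp cm f g)) =
      ∑ p ∈ Finset.HasAntidiagonal.antidiagonal n,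
        shiftTerm Sum.inl cp cm p.1 f * shiftTerm Sum.inr (-cp) (-cm) p.2 g := by
  rw [integrand, map_mul diag, map_mul diag, diag_expSeries c hc, one_mul,
    wCoeff_diag_shift_mul (Or.inl rfl) (Or.inr rfl)]

theorem oddsUpTo_one : oddsUpTo 1 = {⟨1, by decide⟩} := by decide

theorem oddsUpTo_two : oddsUpTo 2 = {⟨1, by decide⟩} := by decide

theorem oddsUpTo_three : oddsUpTo 3 = {⟨1, by decide⟩, ⟨3, by decide⟩} := by decide

theorem shiftTerm_one {e : Times → Times2} (he : e = Sum.inl ∨ e = Sum.inr) (cp cm : ℂ)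
    (f : MvPowerSeries Times ℂ) : shiftTerm e cp cm 1 f =
      2 * (MvPowerSeries.C cp * MvPowerSeries.pderiv ℂ t1 f +
        MvPowerSeries.C cm * MvPowerSeries.pderiv ℂ tm1 f) := by
  have h := shiftTerm_succ he cp cm 1 f
  rw [Nat.cast_one, one_mul, oddsUpTo_one, Finset.sum_singleton] at h
  simpa [shiftTerm_zero he, t1, tm1] using h

theorem shiftTerm_two {e : Times → Times2} (he : e = Sum.inl ∨ e = Sum.inr) (cp : ℂ)
    (f : MvPowerSeries Times ℂ) : 2 * shiftTerm e cp 0 2 f =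
      2 * (MvPowerSeries.C cp * (2 * (MvPowerSeries.C cp *
        MvPowerSeries.pderiv ℂ t1 (MvPowerSeries.pderiv ℂ t1 f)))) := by
  have h := shiftTerm_succ he cp 0 2 f
  rw [oddsUpTo_two, Finset.sum_singleton] at h
  simpa [shiftTerm_one he, t1, tm1] using h

theorem shiftTerm_three {e : Times → Times2} (he : e = Sum.inl ∨ e = Sum.inr) (cp : ℂ)
    (f : MvPowerSeries Times ℂ) : 3 * shiftTerm e cp 0 3 f =
      2 * (MvPowerSeries.C cp * shiftTerm e cp 0 2 (MvPowerSeries.pderiv ℂ t1 f) +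
        MvPowerSeries.C cp * MvPowerSeries.pderiv ℂ t3 f) := by
  have h := shiftTerm_succ he cp 0 3 f
  rw [oddsUpTo_three, Finset.sum_pair (by decide)] at h
  simpa [shiftTerm_zero he, t1, t3] using h

/-- Keeps just what is used of the exponent: antisymmetry, the factor `2 w^{-3}` that `D_3`
extracts, and its independence of `t_{-1}`. -/
theorem exists_xiPlus : ∃ c : Times2 → LaurentSeries ℂ, xiPlus = linSeries c ∧
    (∀ s, c (Sum.inl s) + c (Sum.inr s) = 0) ∧
    c (Sum.inl t3) - c (Sum.inr t3) = wPow (-3) + wPow (-3) ∧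
    c (Sum.inl tm1) - c (Sum.inr tm1) = 0 := by
  refine ⟨_, rfl, ?_, ?_, ?_⟩
  · rintro (k | k) <;> simp
  · simp [t3]
  · simp [tm1]

theorem exists_xiMinus : ∃ c : Times2 → LaurentSeries ℂ, xiMinus = linSeries c ∧
    (∀ s, c (Sum.inl s) + c (Sum.inr s) = 0) ∧
    c (Sum.inl t3) - c (Sum.inr t3) = 0 ∧
    c (Sum.inl tm1) - c (Sum.inr tm1) = -(wPow (-1) + wPow (-1)) := by
  refine ⟨_, rfl, ?_, ?_, ?_⟩
  · rintro (k | k) <;> simp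
  · simp [t3]
  · simp [tm1]
    ring

theorem wCoeff_zero_diag_integrand (c : Times2 → LaurentSeries ℂ)
    (hc : ∀ s, c (Sum.inl s) + c (Sum.inr s) = 0) (cp cm : ℂ) (f g : MvPowerSeries Times ℂ) :
    wCoeff 0 (diag (integrand c cp cm f g)) = f * g := by
  have h := wCoeff_diag_integrand c hc cp cm f g 0
  rw [Nat.cast_zero] at h
  rw [h]
  simp [shiftTerm_zero]

theorem wCoeff_one_diag_integrand (c : Times2 → LaurentSeries ℂ)
    (hc : ∀ s, c (Sum.inl s) + c (Sum.inr s) = 0) (f g : MvPowerSeries Times ℂ) :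
    wCoeff 1 (diag (integrand c 0 1 f g)) =
      2 * (MvPowerSeries.pderiv ℂ tm1 f * g - f * MvPowerSeries.pderiv ℂ tm1 g) := by
  have h := wCoeff_diag_integrand c hc 0 1 f g 1
  rw [Nat.cast_one, Finset.Nat.sum_antidiagonal_eq_sum_range_succ_mk] at h
  rw [h]
  simp [Finset.sum_range_succ, shiftTerm_zero, shiftTerm_one]
  ring

/-- Formally `f(t - [w]) g(t + [w])` is `exp(2 w D_1 + (2/3) w^3 D_3 + …) g · f`, whose `w^3`
coefficient is `(4/3) D_1^3 + (2/3) D_3`. -/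
theorem wCoeff_three_diag_integrand (c : Times2 → LaurentSeries ℂ)
    (hc : ∀ s, c (Sum.inl s) + c (Sum.inr s) = 0) (f g : MvPowerSeries Times ℂ) :
    3 * wCoeff 3 (diag (integrand c (-1) 0 f g)) =
      2 * (f * MvPowerSeries.pderiv ℂ t3 g - MvPowerSeries.pderiv ℂ t3 f * g) +
      4 * hirota [t1, t1, t1] g f := by
  have h := wCoeff_diag_integrand c hc (-1) 0 f g 3
  rw [Nat.cast_ofNat, Finset.Nat.sum_antidiagonal_eq_sum_range_succ_mk] at h
  rw [h]
  have hl : (Sum.inl : Times → Times2) = Sum.inl ∨ (Sum.inl : Times → Times2) = Sum.inr :=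
    Or.inl rfl
  have hr : (Sum.inr : Times → Times2) = Sum.inl ∨ (Sum.inr : Times → Times2) = Sum.inr :=
    Or.inr rfl
  have h2 : (2 : MvPowerSeries Times ℂ) ≠ 0 := by
    intro h
    simpa only [map_ofNat, map_zero, OfNat.ofNat_ne_zero] using
      congrArg MvPowerSeries.constantCoeff h
  have f2 := mul_left_cancel₀ h2 (shiftTerm_two hl (-1) f)
  have f2' := mul_left_cancel₀ h2 (shiftTerm_two hl (-1) (MvPowerSeries.pderiv ℂ t1 f))
  have f3 := shiftTerm_three hl (-1) f
  have g2 := mul_left_cancel₀ h2 (shiftTerm_two hr 1 g)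
  have g2' := mul_left_cancel₀ h2 (shiftTerm_two hr 1 (MvPowerSeries.pderiv ℂ t1 g))
  have g3 := shiftTerm_three hr 1 g
  rw [f2'] at f3
  rw [g2'] at g3
  simp only [map_neg, map_one, neg_mul, one_mul] at f2 f3 g2 g3
  simp only [Finset.sum_range_succ, Finset.range_zero, Finset.sum_empty, zero_add, Nat.sub_zero,
    Nat.sub_self, Nat.reduceSub, neg_neg, neg_zero, shiftTerm_zero hl, shiftTerm_zero hr,
    shiftTerm_one hl, shiftTerm_one hr, f2, g2, map_neg, map_one, map_zero, neg_mul, one_mul,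
    zero_mul, add_zero, hirota]
  linear_combination f * g3 + g * f3

theorem wCoeff_neg_C_wPow_mul {σ : Type} (n l : ℤ) (F : MvPowerSeries σ (LaurentSeries ℂ)) :
    wCoeff n (-(MvPowerSeries.C (wPow l) + MvPowerSeries.C (wPow l)) * F) =
      -(2 * wCoeff (n - l) F) := by
  have h : -(MvPowerSeries.C (wPow l) + MvPowerSeries.C (wPow l)) * F =
      -(MvPowerSeries.C (wPow l) * F + MvPowerSeries.C (wPow l) * F) := by ring
  rw [h, map_neg, map_add, wCoeff_C_wPow_mul, two_mul]

theorem firstMember_of_negativeBKP {f : MvPowerSeries Times ℂ} (hf : NegativeBKP f) :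
    FirstMember f := by
  obtain ⟨c, hcx, hc, hc3, hc1⟩ := exists_xiPlus
  obtain ⟨c', hcx', hc', hc3', hc1'⟩ := exists_xiMinus
  have h : wCoeff 0 (integrand c (-1) 0 f f) = wCoeff 0 (integrand c' 0 1 f f) := by
    rw [integrand, integrand, neg_neg, neg_zero, ← hcx, ← hcx']
    exact hf
  -- `D_3` brings `2 w^{-3}` out of the left exponential, and `D_{-1}` brings `-2 w^{-1}` out of the
  -- right one. The contributions in which both act on the shifted series coincide and cancel.
  have h1 := congrArg (fun F => diag (diffD tm1 (diffD t3 F))) h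
  simp only [diffD_wCoeff, diag_wCoeff, diffD_diffD_integrand, hc3, hc1, hc3', hc1', mul_zero,
    zero_mul, map_zero, zero_add, add_zero, map_neg, map_add, map_sub, map_mul, map_ofNat, add_mul,
    wCoeff_neg_C_wPow_mul, wCoeff_C_wPow_mul, zero_sub, neg_neg, wCoeff_zero_diag_integrand c hc,
    wCoeff_zero_diag_integrand c' hc', wCoeff_one_diag_integrand c' hc'] at h1
  have hl := wCoeff_three_diag_integrand c hc (MvPowerSeries.pderiv ℂ tm1 f) f
  have hr := wCoeff_three_diag_integrand c hc f (MvPowerSeries.pderiv ℂ tm1 f)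
  -- With `A = D_{-1} D_3 f · f` and `B = D_{-1} D_1^3 f · f`, three times the identity reads `-4 A
  -- - 8 B = -12 A`, so a factor 8 has to be cancelled.
  have h8 : (8 : MvPowerSeries Times ℂ) ≠ 0 := by
    intro h
    simpa only [map_ofNat, map_zero, OfNat.ofNat_ne_zero] using
      congrArg MvPowerSeries.constantCoeff h
  refine (mul_eq_zero.mp ?_ : (8 : MvPowerSeries Times ℂ) = 0 ∨ _).resolve_left h8
  simp only [hirota, pderiv_comm _ tm1] at hl hr h1 ⊢
  linear_combination 3 * h1 - 2 * hl + 2 * hr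

end NegBKP

end

theorem mainTheorem6 (G : NegBKP.Op) (hG : NegBKP.IsFermionic G) (hb : NegBKP.BasicBilinear G) :
    NegBKP.tau G =
        (2 : ℂ) • NegBKP.matrixElement G (NegBKP.braOf (NegBKP.phi 0))
          (NegBKP.ketOf (NegBKP.phi 0)) ∧
      NegBKP.NegativeBKP (NegBKP.tau G) ∧
      NegBKP.FirstMember (NegBKP.tau G) ∧
      ∀ f : MvPowerSeries NegBKP.Times ℂ, NegBKP.NegativeBKP f → NegBKP.FirstMember f :=
  ⟨NegBKP.tau_eq hG, NegBKP.negativeBKP_tau hG hb,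
    NegBKP.firstMember_of_negativeBKP (NegBKP.negativeBKP_tau hG hb),
    fun _ => NegBKP.firstMember_of_negativeBKP⟩
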